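/- **Setting.** A monoid $\mathcal R$ with unit group $W$ and set of idempotents $E(\mathcal R)$ is *factorizable* if $\mathcal R=E(\mathcal R)W=WE(\mathcal R)$ and its idempotents commute; then $E(\mathcal R)$ is a meet semilattice for $e\le f\Leftrightarrow ef=fe=e$, with meet $ef$. A *(generalized) Renner–Coxeter system* is a triple $(\mathcal R,\Lambda,S)$ such that: $\mathcal R$ is a factorizable monoid; $\Lambda\subseteq E(\mathcal R)$ is closed under products and contains exactly one element of each orbit of $W$ acting on $E(\mathcal R)$ by conjugation; $(W,S)$ is a Coxeter system; for all $e\le e'$ in $E(\mathcal R)$ there are $w\in W$ and $f\le f'$ in $\Lambda$ with $wew^{-1}=f$, $we'w^{-1}=f'$; writing $\lambda^*(e)=\{s\in S: se=es\ne e\}$, $e\le f$ in $\Lambda$ implies $\lambda^*(e)\subseteq\lambda^*(f)$; and for each $e\in\Lambda$ the groups $\{w\in W: we=ew\}$ and $\{w\in W: we=ew=e\}$ are standard parabolic subgroups of $W$. These groups are $W_{\lambda(e)}$ and $W_{\lambda_*(e)}$ with $\lambda(e)=\{s\in S:se=es\}$, $\lambda_*(e)=\{s\in S:se=es=e\}$,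 where $W_I=\langle I\rangle$ for $I\subseteq S$. Let $\le$ also denote the Bruhat order on $W$ ($u\le v$ if some reduced word of $v$ has a subword that is a reduced word of $u$). Let $W^I$ (resp. ${}^IW$) be the set of $u\in W$ with $u\le v$ for all $v\in uW_I$ (resp. $v\in W_Iu$). Every $r\in\mathcal R$ is uniquely $r=xey$ with $e\in\Lambda$, $x\in W^{\lambda_*(e)}$, $y\in{}^{\lambda(e)}W$ (left standard form), and uniquely $r=yex$ with $e\in\Lambda$, $y\in W^{\lambda(e)}$, $x\in{}^{\lambda_*(e)}W$ (right standard form). The adherence orders are: * for $r=xey$, $s=afb$ in left standard form, $r\le^+s$ iff $e\le f$ and there is $w\in W_{\lambda^*(f)}W_{\lambda_*(e)}$ with $x\le aw$ and $w^{-1}b\le y$; * for $r=yex$, $s=bfa$ in right standard form, $r\le^-s$ iff $e\le f$ and there is $w\in W_{\lambda_*(e)}W_{\lambda^*(f)}$ with $x\le wa$ and $bw^{-1}\le y$. Green's relations are: $r\,\mathcal J\,s$ iff $\mathcal Rr\mathcal R=\mathcal Rs\mathcal R$; $r\,\mathcal L\,s$ iff $\mathcal Rr=\mathcal Rs$; $r\,\mathcal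 R\,s$ iff $r\mathcal R=s\mathcal R$; $\mathcal H=\mathcal L\cap\mathcal R$. For such a relation $\mathcal T$, $T_r$ is the $\mathcal T$-class of $r$, and $\min^\varepsilon T_r$ (resp. $\max^\varepsilon T_r$) is the element of $T_r$ that is $\le^\varepsilon$ (resp. $\ge^\varepsilon$) every element of $T_r$. **Theorem.** (a) Let $(\mathcal R,\Lambda,S)$ be a Renner–Coxeter system with $\mathcal R$ finite, let $\varepsilon\in\{+,-\}$ and $r,s\in\mathcal R$. For each of the relations $\mathcal T=\mathcal J,\mathcal L,\mathcal R,\mathcal H$ the elements $\min^\varepsilon T_r$ and $\max^\varepsilon T_r$ exist and are unique. Consider the statements 1. $\min^\varepsilon T_r\le^\varepsilon\min^\varepsilon T_s$; 2. $\max^\varepsilon T_r\le^\varepsilon\max^\varepsilon T_s$; 3. there are $a\in T_r$ and $b\in T_s$ with $a\le^\varepsilon b$. If $\mathcal T$ is $\mathcal J$, $\mathcal L$ or $\mathcal R$, then (1), (2) and (3) are equivalent. If $\mathcal T=\mathcal H$, then (2) and (3) are equivalent. (b) For $\mathcal T=\mathcal H$, statement (1) is in general not equivalent to (2) and (3), for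 either sign. Indeed, the $3\times3$ rook monoid ($0$-$1$ matrices with at most one $1$ in each row and each column), with $S$ the permutation matrices of the two adjacent transpositions and $\Lambda=\{\operatorname{diag}(1^k,0^{3-k}):0\le k\le3\}$, is a Renner–Coxeter system, and with $E_{ij}$ the matrix units and $r=E_{22}+E_{31}$, $s=E_{13}+E_{22}+E_{31}$ one has $r\le^+s$, $\min^+H_r=E_{21}+E_{32}$, $\min^+H_s=I$ (the identity matrix), but $\min^+H_r\not\le^+\min^+H_s$. (This contradicts a claimed result of Pennell, Putcha and Renner.) Moreover, for each $\varepsilon\in\{+,-\}$ there are $r,s$ in this monoid for which (2) and (3) hold and (1) fails for $\mathcal T=\mathcal H$. -/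

import Mathlib

namespace RennerCoxeter

/-! ### Coxeter groups: Bruhat order, standard parabolic subgroups, minimal coset representatives -/

section Coxeter

variable {W : Type*} [Group W] {B : Type*} {M : CoxeterMatrix B}

/-- The Bruhat order: `u ≤ v` when some reduced word of `v` has a subword that is a reduced word
of `u`. -/
def BruhatLE (cs : CoxeterSystem M W) (u v : W) : Prop :=
  ∃ ω ω' : List B, cs.IsReduced ω ∧ cs.wordProd ω = v ∧
    cs.IsReduced ω' ∧ cs.wordProd ω' = u ∧ List.Sublist ω' ω

/-- The standard parabolic subgroup `W_I`. -/
def parabolic (cs : CoxeterSystem M W) (I : Set B) : Subgroup W :=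
  Subgroup.closure (cs.simple '' I)

/-- The set `ᴵWᴶ` of the elements `u` that are the minimum of the double coset `W_I u W_J`. -/
def minReps (cs : CoxeterSystem M W) (I J : Set B) : Set W :=
  {u | ∀ p ∈ parabolic cs I, ∀ q ∈ parabolic cs J, BruhatLE cs u (p * u * q)}

end Coxeter

/-! ### Monoids: idempotents, factorizability, Green's relations -/

section Monoid

variable {R : Type*} [Monoid R]

/-- The partial order on idempotents: `e ≤ f` when `e f = f e = e`. -/
def IdemLE (e f : R) : Prop := e * f = e ∧ f * e = e

/-- A factorizable monoid: `R = E(R) G(R) = G(R) E(R)` with commuting idempotents, so that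
`E(R)` is a meet semilattice with meet `e f`. -/
structure IsFactorizable (R : Type*) [Monoid R] : Prop where
  idem_mul_unit : ∀ r : R, ∃ e : R, IsIdempotentElem e ∧ ∃ u : Rˣ, r = e * u
  unit_mul_idem : ∀ r : R, ∃ e : R, IsIdempotentElem e ∧ ∃ u : Rˣ, r = u * e
  idem_comm : ∀ e f : R, IsIdempotentElem e → IsIdempotentElem f → e * f = f * e

/-- `r 𝓙 s`: `RrR = RsR`. -/
def greenJ (r s : R) : Prop := {t : R | ∃ a b, t = a * r * b} = {t : R | ∃ a b, t = a * s * b}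

/-- `r 𝓛 s`: `Rr = Rs`. -/
def greenL (r s : R) : Prop := {t : R | ∃ a, t = a * r} = {t : R | ∃ a, t = a * s}

/-- `r 𝓡 s`: `rR = sR`. -/
def greenR (r s : R) : Prop := {t : R | ∃ b, t = r * b} = {t : R | ∃ b, t = s * b}

/-- `r 𝓗 s`: `r 𝓛 s` and `r 𝓡 s`. -/
def greenH (r s : R) : Prop := greenL r s ∧ greenR r s

end Monoid

/-! ### Renner-Coxeter systems -/

section TypeMaps

variable {R : Type*} [Monoid R] {B : Type*} {M : CoxeterMatrix B}

/-- The type map `λ(e) = {s ∈ S | s e = e s}`. -/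
def typeMap (cs : CoxeterSystem M Rˣ) (e : R) : Set B :=
  {i | (cs.simple i : R) * e = e * (cs.simple i : R)}

/-- The lower type map `λ_*(e) = {s ∈ S | s e = e s = e}`. -/
def lowerType (cs : CoxeterSystem M Rˣ) (e : R) : Set B :=
  {i | (cs.simple i : R) * e = e * (cs.simple i : R) ∧ (cs.simple i : R) * e = e}

/-- The upper type map `λ^*(e) = {s ∈ S | s e = e s ≠ e}`. -/
def upperType (cs : CoxeterSystem M Rˣ) (e : R) : Set B :=
  {i | (cs.simple i : R) * e = e * (cs.simple i : R) ∧ (cs.simple i : R) * e ≠ e}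

end TypeMaps

/-- A (generalized) Renner-Coxeter system `(R, Λ, S)`. The group of units `Rˣ` is the Coxeter
group `W`, the set of generators is `S = {cs.simple i | i : B}`, and `Lam` is the cross-sectional
lattice `Λ`. -/
structure RennerCoxeterSystem (R : Type*) [Monoid R] {B : Type*} (M : CoxeterMatrix B) where
  factorizable : IsFactorizable R
  cs : CoxeterSystem M Rˣ
  Lam : Set R
  isIdempotentElem_of_mem : ∀ e ∈ Lam, IsIdempotentElem e
  transversal : ∀ e : R, IsIdempotentElem e →
    ∃! f : R, f ∈ Lam ∧ ∃ w : Rˣ, (w : R) * e * ((w⁻¹ : Rˣ) : R) = f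
  mul_mem : ∀ e ∈ Lam, ∀ f ∈ Lam, e * f ∈ Lam
  conj_pair : ∀ e e' : R, IsIdempotentElem e → IsIdempotentElem e' → IdemLE e e' →
    ∃ w : Rˣ, ∃ f ∈ Lam, ∃ f' ∈ Lam, IdemLE f f' ∧
      (w : R) * e * ((w⁻¹ : Rˣ) : R) = f ∧ (w : R) * e' * ((w⁻¹ : Rˣ) : R) = f'
  upperType_mono : ∀ e ∈ Lam, ∀ f ∈ Lam, IdemLE e f → upperType cs e ⊆ upperType cs f
  centralizer_parabolic : ∀ e ∈ Lam, ∃ I : Set B, ∀ w : Rˣ,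
    (w : R) * e = e * (w : R) ↔ w ∈ parabolic cs I
  fixer_parabolic : ∀ e ∈ Lam, ∃ I : Set B, ∀ w : Rˣ,
    ((w : R) * e = e * (w : R) ∧ (w : R) * e = e) ↔ w ∈ parabolic cs I

namespace RennerCoxeterSystem

variable {R : Type*} [Monoid R] {B : Type*} {M : CoxeterMatrix B}

/-- `r = x e y` is in left standard form: `e ∈ Λ`, `x ∈ W^{λ_*(e)}`, `y ∈ ^{λ(e)}W`. -/
def IsLeftStandard (sys : RennerCoxeterSystem R M) (r : R) (x : Rˣ) (e : R) (y : Rˣ) : Prop :=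
  r = x * e * y ∧ e ∈ sys.Lam ∧ x ∈ minReps sys.cs ∅ (lowerType sys.cs e) ∧
    y ∈ minReps sys.cs (typeMap sys.cs e) ∅

/-- `r = y e x` is in right standard form: `e ∈ Λ`, `x ∈ ^{λ_*(e)}W`, `y ∈ W^{λ(e)}`. -/
def IsRightStandard (sys : RennerCoxeterSystem R M) (r : R) (y : Rˣ) (e : R) (x : Rˣ) : Prop :=
  r = y * e * x ∧ e ∈ sys.Lam ∧ x ∈ minReps sys.cs (lowerType sys.cs e) ∅ ∧
    y ∈ minReps sys.cs ∅ (typeMap sys.cs e)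

/-- The adherence order `≤⁺`. -/
def PlusLE (sys : RennerCoxeterSystem R M) (r s : R) : Prop :=
  ∃ (x : Rˣ) (e : R) (y a : Rˣ) (f : R) (b : Rˣ),
    sys.IsLeftStandard r x e y ∧ sys.IsLeftStandard s a f b ∧ IdemLE e f ∧
    ∃ p ∈ parabolic sys.cs (upperType sys.cs f), ∃ q ∈ parabolic sys.cs (lowerType sys.cs e),
      BruhatLE sys.cs x (a * (p * q)) ∧ BruhatLE sys.cs ((p * q)⁻¹ * b) y

/-- The adherence order `≤⁻`. -/
def MinusLE (sys : RennerCoxeterSystem R M) (r s : R) : Prop :=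
  ∃ (y : Rˣ) (e : R) (x b : Rˣ) (f : R) (a : Rˣ),
    sys.IsRightStandard r y e x ∧ sys.IsRightStandard s b f a ∧ IdemLE e f ∧
    ∃ p ∈ parabolic sys.cs (lowerType sys.cs e), ∃ q ∈ parabolic sys.cs (upperType sys.cs f),
      BruhatLE sys.cs x (p * q * a) ∧ BruhatLE sys.cs (b * (p * q)⁻¹) y

end RennerCoxeterSystem

/-- The sign `ε`. -/
inductive AdherenceSign
  | plus
  | minus

namespace RennerCoxeterSystem

variable {R : Type*} [Monoid R] {B : Type*} {M : CoxeterMatrix B}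

/-- The adherence order `≤^ε`. -/
def AdhLE (sys : RennerCoxeterSystem R M) : AdherenceSign → R → R → Prop
  | .plus => sys.PlusLE
  | .minus => sys.MinusLE

/-- `m` is the absolute minimum `min^ε T_r` of the `T`-class of `r`. -/
def IsAbsMin (sys : RennerCoxeterSystem R M) (ε : AdherenceSign) (T : R → R → Prop) (r m : R) :
    Prop :=
  T r m ∧ ∀ t, T r t → sys.AdhLE ε m t

/-- `m` is the absolute maximum `max^ε T_r` of the `T`-class of `r`. -/
def IsAbsMax (sys : RennerCoxeterSystem R M) (ε : AdherenceSign) (T : R → R → Prop) (r m : R) :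
    Prop :=
  T r m ∧ ∀ t, T r t → sys.AdhLE ε t m

/-- `min^ε T_r ≤^ε min^ε T_s` (both minima being defined). -/
def AbsMinLE (sys : RennerCoxeterSystem R M) (ε : AdherenceSign) (T : R → R → Prop) (r s : R) :
    Prop :=
  ∃ m m', sys.IsAbsMin ε T r m ∧ sys.IsAbsMin ε T s m' ∧ sys.AdhLE ε m m'

/-- `max^ε T_r ≤^ε max^ε T_s` (both maxima being defined). -/
def AbsMaxLE (sys : RennerCoxeterSystem R M) (ε : AdherenceSign) (T : R → R → Prop) (r s : R) :
    Prop :=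
  ∃ m m', sys.IsAbsMax ε T r m ∧ sys.IsAbsMax ε T s m' ∧ sys.AdhLE ε m m'

/-- Some `a ∈ T_r` and `b ∈ T_s` satisfy `a ≤^ε b`. -/
def SomeLE (sys : RennerCoxeterSystem R M) (ε : AdherenceSign) (T : R → R → Prop) (r s : R) :
    Prop :=
  ∃ a b, T r a ∧ T s b ∧ sys.AdhLE ε a b

end RennerCoxeterSystem

/-! ### The rook monoid -/

/-- The `n × n` rook monoid: matrices over `ℕ` all of whose row and column sums are at most `1`,
that is, `0`-`1` matrices with at most one `1` in each row and in each column. -/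
def rookMonoid (n : ℕ) : Submonoid (Matrix (Fin n) (Fin n) ℕ) where
  carrier := {A | (∀ i, ∑ j, A i j ≤ 1) ∧ ∀ j, ∑ i, A i j ≤ 1}
  one_mem' := by
    constructor <;> intro i <;> simp [Matrix.one_apply]
  mul_mem' := by
    rintro A C ⟨hA, hA'⟩ ⟨hC, hC'⟩
    refine ⟨fun i => ?_, fun j => ?_⟩
    · simp only [Matrix.mul_apply]
      rw [Finset.sum_comm]
      calc ∑ k, ∑ j, A i k * C k j = ∑ k, A i k * ∑ j, C k j := by simp [Finset.mul_sum]
        _ ≤ ∑ k, A i k * 1 := Finset.sum_le_sum fun k _ => Nat.mul_le_mul_left _ (hC k)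
        _ ≤ 1 := by simpa using hA i
    · simp only [Matrix.mul_apply]
      rw [Finset.sum_comm]
      calc ∑ k, ∑ i, A i k * C k j = ∑ k, (∑ i, A i k) * C k j := by simp [Finset.sum_mul]
        _ ≤ ∑ k, 1 * C k j := Finset.sum_le_sum fun k _ => Nat.mul_le_mul_right _ (hA' k)
        _ ≤ 1 := by simpa using hC' j

/-- The element `E₂₂ + E₃₁` of the `3 × 3` rook monoid. -/
def rookA : rookMonoid 3 := ⟨!![0, 0, 0; 0, 1, 0; 1, 0, 0], by
  constructor <;> intro i <;> fin_cases i <;> simp [Fin.sum_univ_three]⟩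

/-- The element `E₂₁ + E₃₂` of the `3 × 3` rook monoid. -/
def rookB : rookMonoid 3 := ⟨!![0, 0, 0; 1, 0, 0; 0, 1, 0], by
  constructor <;> intro i <;> fin_cases i <;> simp [Fin.sum_univ_three]⟩

/-- The element `E₁₃ + E₂₂ + E₃₁` of the `3 × 3` rook monoid. -/
def rookC : rookMonoid 3 := ⟨!![0, 0, 1; 0, 1, 0; 1, 0, 0], by
  constructor <;> intro i <;> fin_cases i <;> simp [Fin.sum_univ_three]⟩

/-- The standard Renner-Coxeter structures on the `3 × 3` rook monoid: the generators are the
permutation matrices of the two adjacent transpositions, and `Λ` consists of the matrices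
`diag(1, …, 1, 0, …, 0)`. -/
def IsStandardRook (sys : RennerCoxeterSystem (rookMonoid 3) (CoxeterMatrix.A 2)) : Prop :=
  (((sys.cs.simple 0 : (rookMonoid 3)ˣ) : rookMonoid 3) : Matrix (Fin 3) (Fin 3) ℕ) =
      !![0, 1, 0; 1, 0, 0; 0, 0, 1] ∧
  (((sys.cs.simple 1 : (rookMonoid 3)ˣ) : rookMonoid 3) : Matrix (Fin 3) (Fin 3) ℕ) =
      !![1, 0, 0; 0, 0, 1; 0, 1, 0] ∧
  ∀ e : rookMonoid 3, e ∈ sys.Lam ↔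
    (e : Matrix (Fin 3) (Fin 3) ℕ) ∈
      ({1, !![1, 0, 0; 0, 1, 0; 0, 0, 0], !![1, 0, 0; 0, 0, 0; 0, 0, 0], 0} :
        Set (Matrix (Fin 3) (Fin 3) ℕ))

end RennerCoxeter

/-! Every element is encoded by a triple `(x, e, y)` with `e ∈ Λ`, `x` minimal in `x W_*(e)` and `y`
minimal in `W(e) y`; it stands for `x e y` when `ε = +` and for `y⁻¹ e x⁻¹` when `ε = -`. Since
Bruhat order is invariant under inversion, both adherence orders become one relation `LE` on
triples, with a transition element `w` in `W(f) W_*(e)` such that `x ≤ a w` and `w⁻¹ b ≤ y`. Green's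
relations become: same `e` (for `𝓙`), same `e` and `y`, same `e` and `x W(e)`, and both of these at
once (for `𝓗`); the sign only exchanges the roles of `𝓛` and `𝓡`.

Extremal elements are then visible. A smaller `x` and a larger `y` make the element smaller, so each
class has its minimum and maximum at the extreme admissible values of the coordinates that are free.
Uniqueness is antisymmetry of `LE`; transitivity of `LE` is never needed.

Maxima are monotone because the coordinates decouple. If `LE t t'`, then some `q ∈ W_*(e)` alone
satisfies `q⁻¹ b ≤ y` (`LE.exists_fixer_mul_le`), while the maximal `x`-parts satisfy the other
inequality for every `q ∈ W_*(e)` (`LE.xMax_le`, `xTop_le`). Minima are monotone as soon as one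
coordinate imposes no constraint: either `x` is `1`, or `y` is the greatest representative and `w`
can be adjusted by an element of `W(e)` (`exists_yTop_le`). For `𝓗` the same `w` must serve a
minimal `x` and a prescribed `y`, and this is what fails in the rook monoid: with `y = b = 1` and
trivial `W_*(e)` one is forced to `w = 1`, and passing to minima turns `s₀s₁s₀ ≤ s₀s₁s₀` into the
false `s₀s₁ ≤ 1`.

The Coxeter input is the strong exchange property, the lifting property and minimal and maximal
coset representatives, all derived from the action of `W` on `W × ℤ/2`. -/

namespace CoxeterSystem

/-! ### Inversion parity and the strong exchange property. -/

section ReflectionCocycle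

variable {B W : Type*} [Group W] {M : CoxeterMatrix B} (cs : CoxeterSystem M W)

open Classical in
/-- The permutation `(t, ε) ↦ (s t s, ε + [t = s])` of `W × ℤ/2` attached to a simple
reflection `s`. -/
noncomputable def signedConj (i : B) : Equiv.Perm (W × ZMod 2) where
  toFun p := (cs.simple i * p.1 * cs.simple i, p.2 + if p.1 = cs.simple i then 1 else 0)
  invFun p := (cs.simple i * p.1 * cs.simple i, p.2 + if p.1 = cs.simple i then 1 else 0)
  left_inv p := by
    have h : cs.simple i * p.1 * cs.simple i = cs.simple i ↔ p.1 = cs.simple i := by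
      rw [mul_eq_right, ← cs.inv_simple i, inv_mul_eq_one, cs.inv_simple, eq_comm]
    ext
    · simp [mul_assoc]
    · simp only [h, add_assoc, CharTwo.add_self_eq_zero, add_zero]
  right_inv p := by
    have h : cs.simple i * p.1 * cs.simple i = cs.simple i ↔ p.1 = cs.simple i := by
      rw [mul_eq_right, ← cs.inv_simple i, inv_mul_eq_one, cs.inv_simple, eq_comm]
    ext
    · simp [mul_assoc]
    · simp only [h, add_assoc, CharTwo.add_self_eq_zero, add_zero]

open Classical in
theorem signedConj_apply (i : B) (p : W × ZMod 2) :
    cs.signedConj i p =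
      (cs.simple i * p.1 * cs.simple i, p.2 + if p.1 = cs.simple i then 1 else 0) := rfl

open Classical in
-- The elements `s_j (s_i s_j) ^ m` with `m < 2k` are the successive entries of the right inversion
-- sequence of the alternating word `(i j)ᵏ`, so the sign counts the occurrences of `t` among them.
theorem signedConj_mul_pow_apply (i j : B) (k : ℕ) (t : W) (ε : ZMod 2) :
    ((cs.signedConj i * cs.signedConj j) ^ k) (t, ε) =
      ((cs.simple i * cs.simple j) ^ k * t * ((cs.simple i * cs.simple j) ^ k)⁻¹,
        ε + ∑ m ∈ Finset.range (2 * k),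
          if t = cs.simple j * (cs.simple i * cs.simple j) ^ m then 1 else 0) := by
  have key : ∀ n : ℕ, ((cs.simple i * cs.simple j) ^ n)⁻¹ * cs.simple j =
      cs.simple j * (cs.simple i * cs.simple j) ^ n := by
    intro n
    induction n with
    | zero => simp
    | succ n ih =>
      rw [pow_succ, mul_inv_rev, mul_assoc, ih, ← pow_succ, pow_succ']
      simp [mul_assoc]
  induction k with
  | zero => simp
  | succ k ih =>
    rw [pow_succ', Equiv.Perm.mul_apply, ih, Equiv.Perm.mul_apply, signedConj_apply,
      signedConj_apply]
    have h1 : (cs.simple i * cs.simple j) ^ k * t * ((cs.simple i * cs.simple j) ^ k)⁻¹ =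
        cs.simple j ↔ t = cs.simple j * (cs.simple i * cs.simple j) ^ (2 * k) := by
      rw [two_mul, pow_add, ← mul_assoc, ← key, mul_inv_eq_iff_eq_mul, ← eq_inv_mul_iff_mul_eq,
        mul_assoc]
    have h2 : cs.simple j * ((cs.simple i * cs.simple j) ^ k * t *
        ((cs.simple i * cs.simple j) ^ k)⁻¹) * cs.simple j = cs.simple i ↔
        t = cs.simple j * (cs.simple i * cs.simple j) ^ (2 * k + 1) := by
      have : cs.simple j * (cs.simple i * cs.simple j) ^ (2 * k + 1) =
          ((cs.simple i * cs.simple j) ^ k)⁻¹ * (cs.simple j * cs.simple i * cs.simple j) *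
            (cs.simple i * cs.simple j) ^ k := by
        rw [mul_assoc (cs.simple j), ← mul_assoc _ (cs.simple j), key]
        rw [show 2 * k + 1 = k + (1 + k) by ring, pow_add, pow_add, pow_one]
        simp only [mul_assoc]
      rw [this]
      constructor
      · intro h
        generalize (cs.simple i * cs.simple j) ^ k = p at h ⊢
        rw [← h]
        simp [mul_assoc]
      · rintro rfl
        simp [mul_assoc]
    ext
    · simp [pow_succ', mul_assoc]
    · simp only [h1, h2]
      rw [show 2 * (k + 1) = 2 * k + 1 + 1 by ring, Finset.sum_range_succ, Finset.sum_range_succ]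
      ring

/-- For `k = M i j` the sum has `2k` terms, and the terms `m` and `m + k` agree because `(s_i s_j)ᵏ
= 1`; they cancel modulo `2`. -/
theorem isLiftable_signedConj : M.IsLiftable cs.signedConj := by
  classical
  intro i j
  ext1 ⟨t, ε⟩
  rw [signedConj_mul_pow_apply, two_mul, Finset.sum_range_add]
  simp [pow_add, CharTwo.add_self_eq_zero]

/-- The signed conjugation action of `W` on `W × ℤ/2`. -/
noncomputable def signedAction : W →* Equiv.Perm (W × ZMod 2) :=
  cs.lift ⟨cs.signedConj, cs.isLiftable_signedConj⟩

/-- The parity of the number of occurrences of `t` in the right inversion sequence of any word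
for `w`. -/
noncomputable def invParity (w t : W) : ZMod 2 := (cs.signedAction w (t, 0)).2

theorem signedAction_apply (w t : W) (ε : ZMod 2) :
    cs.signedAction w (t, ε) = (w * t * w⁻¹, ε + cs.invParity w t) := by
  have h : ∀ w : W, (∀ t ε, (cs.signedAction w (t, ε)).1 = w * t * w⁻¹) ∧
      ∀ t ε, (cs.signedAction w (t, ε)).2 = ε + (cs.signedAction w (t, 0)).2 := by
    intro w
    induction w using cs.simple_induction_left with
    | one => simp
    | mul_simple_left w i ih =>
      have hs : cs.signedAction (cs.simple i) = cs.signedConj i :=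
        cs.lift_apply_simple cs.isLiftable_signedConj i
      simp only [map_mul, Equiv.Perm.mul_apply, hs, signedConj_apply]
      refine ⟨fun t ε => by simp [ih.1, mul_assoc], fun t ε => ?_⟩
      rw [ih.2 t ε, ih.1 t ε, ih.1 t 0, add_assoc]
  exact Prod.ext ((h w).1 t ε) ((h w).2 t ε)

theorem invParity_mul (u v t : W) :
    cs.invParity (u * v) t = cs.invParity v t + cs.invParity u (v * t * v⁻¹) := by
  rw [invParity, map_mul, Equiv.Perm.mul_apply, signedAction_apply, signedAction_apply, zero_add]

@[simp] theorem invParity_one (t : W) : cs.invParity 1 t = 0 := by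
  simp [invParity]

open Classical in
theorem invParity_simple (i : B) (t : W) :
    cs.invParity (cs.simple i) t = if t = cs.simple i then 1 else 0 := by
  have hs : cs.signedAction (cs.simple i) = cs.signedConj i :=
    cs.lift_apply_simple cs.isLiftable_signedConj i
  simp [invParity, hs, signedConj_apply]

theorem mem_rightInvSeq_of_invParity {ω : List B} {t : W}
    (h : cs.invParity (cs.wordProd ω) t = 1) : t ∈ cs.rightInvSeq ω := by
  classical
  induction ω with
  | nil => simp at h
  | cons i ω ih =>
    rw [wordProd_cons, invParity_mul, invParity_simple] at h
    rw [rightInvSeq, List.mem_cons]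
    by_cases h1 : cs.wordProd ω * t * (cs.wordProd ω)⁻¹ = cs.simple i
    · left
      rw [← h1]
      group
    · right
      rw [if_neg h1, add_zero] at h
      exact ih h

/-- For `t = w s w⁻¹` the cocycle rule splits the parity into contributions of `w⁻¹`, `s` and `w`.
The outer two cancel, as the same rule applied to `w w⁻¹ = 1` shows, and `s` contributes `1`. -/
theorem IsReflection.invParity_self {t : W} (ht : cs.IsReflection t) : cs.invParity t t = 1 := by
  obtain ⟨w, i, rfl⟩ := ht
  have h := cs.invParity_mul w w⁻¹ (w * cs.simple i * w⁻¹)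
  rw [mul_inv_cancel, invParity_one] at h
  rw [invParity_mul, invParity_mul]
  have e1 : w⁻¹ * (w * cs.simple i * w⁻¹) * w⁻¹⁻¹ = cs.simple i := by group
  rw [e1] at h ⊢
  have e2 : cs.simple i * cs.simple i * (cs.simple i)⁻¹ = cs.simple i := by group
  rw [e2, invParity_simple, if_pos rfl, add_left_comm, ← h, add_zero]

/-- Odd parity puts `t` in the inversion sequence of a reduced word, so `t` shortens `w`. If the
parity at `w` is even, it is odd at `w t`, so `t` shortens `w t` back to `w`. -/
theorem IsReflection.length_mul_lt_iff {t : W} (ht : cs.IsReflection t) (w : W) :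
    cs.length (w * t) < cs.length w ↔ cs.invParity w t = 1 := by
  have h : ∀ w, cs.invParity w t = 1 → cs.length (w * t) < cs.length w := by
    intro w hw
    obtain ⟨ω, hω, rfl⟩ := cs.exists_isReduced w
    exact (cs.isRightInversion_of_mem_rightInvSeq hω (cs.mem_rightInvSeq_of_invParity hw)).2
  refine ⟨fun hlt => ?_, h w⟩
  by_contra hne
  have h0 : cs.invParity w t = 0 := by
    generalize cs.invParity w t = x at hne
    revert x
    decide
  have := h (w * t) (by
    rw [invParity_mul, ht.invParity_self, mul_assoc, mul_inv_cancel, mul_one, h0, add_zero])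
  rw [mul_assoc, ht.mul_self, mul_one] at this
  omega

/-- The strong exchange property. -/
theorem IsReflection.exists_eraseIdx {t : W} (ht : cs.IsReflection t) {ω : List B}
    (h : cs.length (cs.wordProd ω * t) < cs.length (cs.wordProd ω)) :
    ∃ j < ω.length, cs.wordProd ω * t = cs.wordProd (ω.eraseIdx j) := by
  obtain ⟨j, hj, rfl⟩ := List.mem_iff_getElem.mp
    (cs.mem_rightInvSeq_of_invParity ((ht.length_mul_lt_iff cs _).1 h))
  refine ⟨j, by simpa using hj, ?_⟩
  rw [← List.getD_eq_getElem _ 1 hj, wordProd_mul_getD_rightInvSeq]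

/-- Every word has a reduced subword with the same product. -/
theorem exists_isReduced_sublist (ω : List B) :
    ∃ ω', cs.IsReduced ω' ∧ cs.wordProd ω' = cs.wordProd ω ∧ List.Sublist ω' ω := by
  induction ω with
  | nil => exact ⟨[], by simp [IsReduced], rfl, List.Sublist.refl _⟩
  | cons i ω ih =>
    obtain ⟨γ, hγ, hp, hs⟩ := ih
    rcases cs.length_simple_mul (cs.wordProd γ) i with h | h
    · exact ⟨i :: γ, by rw [IsReduced, wordProd_cons, h, hγ.eq]; simp,
        by rw [wordProd_cons, wordProd_cons, hp], hs.cons_cons i⟩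
    -- Left multiplication by `s_i` is right multiplication by a conjugate reflection, so strong
    -- exchange deletes a letter of `γ`.
    · have ht : cs.IsReflection ((cs.wordProd γ)⁻¹ * cs.simple i * cs.wordProd γ) :=
        ⟨(cs.wordProd γ)⁻¹, i, by simp⟩
      have he : cs.wordProd γ * ((cs.wordProd γ)⁻¹ * cs.simple i * cs.wordProd γ) =
          cs.simple i * cs.wordProd γ := by group
      obtain ⟨j, hj, hj'⟩ := ht.exists_eraseIdx cs (ω := γ) (by rw [he]; omega)
      rw [he] at hj'
      refine ⟨γ.eraseIdx j, ?_, by rw [← hj', wordProd_cons, hp],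
        ((γ.eraseIdx_sublist j).trans hs).cons i⟩
      have := List.length_eraseIdx_add_one hj
      have := hγ.eq
      rw [IsReduced, ← hj']
      omega

end ReflectionCocycle

end CoxeterSystem

namespace RennerCoxeter

/-! ### Bruhat order: reflection chains, subwords and lifting. -/

section Bruhat

variable {B W : Type*} [Group W] {M : CoxeterMatrix B} {cs : CoxeterSystem M W}

/-- `v` is obtained from `u` by a length-increasing multiplication with a reflection. -/
def BruhatStep (cs : CoxeterSystem M W) (u v : W) : Prop :=
  ∃ t, cs.IsReflection t ∧ v = u * t ∧ cs.length u < cs.length v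

theorem BruhatStep.simple_mul {c : W} {i : B} (h : cs.length c < cs.length (cs.simple i * c)) :
    BruhatStep cs c (cs.simple i * c) :=
  ⟨c⁻¹ * cs.simple i * c, ⟨c⁻¹, i, by simp⟩, by group, h⟩

/-- By the cocycle rule, the parity of `t` at `s c` equals its parity at `c` unless `c t c⁻¹ = s`,
that is, unless `s c = c t`. Otherwise `t` still increases length. -/
theorem BruhatStep.eq_or_step {c d : W} (h : BruhatStep cs c d) (i : B) :
    cs.simple i * c = d ∨ BruhatStep cs (cs.simple i * c) (cs.simple i * d) := by
  classical
  obtain ⟨t, ht, rfl, hlt⟩ := h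
  by_cases he : c * t * c⁻¹ = cs.simple i
  · left
    rw [← he]
    group
  · right
    refine ⟨t, ht, by rw [mul_assoc], ?_⟩
    have h1 : cs.invParity c t ≠ 1 := fun h => by
      have := (ht.length_mul_lt_iff cs c).2 h
      omega
    have h2 : ¬ cs.length (cs.simple i * c * t) < cs.length (cs.simple i * c) := by
      rw [ht.length_mul_lt_iff, cs.invParity_mul, cs.invParity_simple, if_neg he, add_zero]
      exact h1
    have h3 := ht.length_mul_left_ne (cs.simple i * c)
    rw [← mul_assoc]
    omega

theorem chain_simple_mul {c d : W} (h : Relation.ReflTransGen (BruhatStep cs) c d) (i : B) :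
    Relation.ReflTransGen (BruhatStep cs) (cs.simple i * c) d ∨
      Relation.ReflTransGen (BruhatStep cs) (cs.simple i * c) (cs.simple i * d) := by
  induction h using Relation.ReflTransGen.head_induction_on with
  | refl => exact Or.inr .refl
  | head h h' ih =>
    rcases h.eq_or_step i with rfl | hs
    · exact Or.inl h'
    · exact ih.imp (fun ih => .head hs ih) fun ih => .head hs ih

theorem chain_simple_mul' {c d : W} (h : Relation.ReflTransGen (BruhatStep cs) c d) (i : B) :
    Relation.ReflTransGen (BruhatStep cs) c (cs.simple i * d) ∨
      Relation.ReflTransGen (BruhatStep cs) (cs.simple i * c) (cs.simple i * d) := by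
  induction h with
  | refl => exact Or.inr .refl
  | tail h' h ih =>
    rcases h.eq_or_step i with rfl | hs
    · left
      simpa using h'
    · exact ih.imp (fun ih => .tail ih hs) fun ih => .tail ih hs

/-- The subword `ω'` need not be reduced, which lets the induction on the sublist run. When a common
first letter is added, the lifting property `chain_simple_mul` applies, together with the fact that
this letter lengthens the product of the rest of `ω`. -/
theorem chain_of_sublist {ω ω' : List B} (h : List.Sublist ω' ω) (hω : cs.IsReduced ω) :
    Relation.ReflTransGen (BruhatStep cs) (cs.wordProd ω') (cs.wordProd ω) := by
  induction h with
  | slnil => exact .refl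
  | cons i h ih =>
    rename_i l₁ l₂
    have hl : cs.IsReduced l₂ := by simpa using hω.drop 1
    have := hω.eq
    have := hl.eq
    rw [cs.wordProd_cons] at *
    refine (ih hl).tail (BruhatStep.simple_mul ?_)
    simp_all
  | cons_cons i h ih =>
    rename_i l₁ l₂
    have hl : cs.IsReduced l₂ := by simpa using hω.drop 1
    have h1 := hω.eq
    have h2 := hl.eq
    rw [cs.wordProd_cons] at h1
    rw [cs.wordProd_cons, cs.wordProd_cons]
    rcases chain_simple_mul (ih hl) i with h3 | h3
    · refine h3.tail (BruhatStep.simple_mul ?_)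
      simp_all
    · exact h3

/-- Each step down the chain deletes one letter by strong exchange. Since `ω` is an arbitrary word
for `v`, the shortened words need not be reduced until the end of the chain. -/
theorem exists_sublist_of_chain {u v : W} (h : Relation.ReflTransGen (BruhatStep cs) u v)
    {ω : List B} (hω : cs.wordProd ω = v) :
    ∃ ω', cs.IsReduced ω' ∧ cs.wordProd ω' = u ∧ List.Sublist ω' ω := by
  induction h generalizing ω with
  | refl => exact hω ▸ cs.exists_isReduced_sublist ω
  | tail h' h ih =>
    obtain ⟨t, ht, rfl, hlt⟩ := h
    rename_i d
    have hd : d = cs.wordProd ω * t := by rw [hω, mul_assoc, ht.mul_self, mul_one]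
    rw [← hω] at hlt
    obtain ⟨j, -, hj⟩ := ht.exists_eraseIdx cs (ω := ω) (hd ▸ hlt)
    obtain ⟨ω', h1, h2, h3⟩ := ih (hj.symm.trans hd.symm)
    exact ⟨ω', h1, h2, h3.trans (ω.eraseIdx_sublist j)⟩

/-- The chain form makes transitivity evident, which the definition by one chosen reduced word does
not. -/
theorem bruhatLE_iff_chain {u v : W} :
    BruhatLE cs u v ↔ Relation.ReflTransGen (BruhatStep cs) u v := by
  constructor
  · rintro ⟨ω, ω', hω, rfl, -, rfl, hs⟩
    exact chain_of_sublist hs hω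
  · intro h
    obtain ⟨ω, hω, rfl⟩ := cs.exists_isReduced v
    obtain ⟨ω', h1, h2, h3⟩ := exists_sublist_of_chain h rfl
    exact ⟨ω, ω', hω, rfl, h1, h2, h3⟩

theorem BruhatLE.refl (u : W) : BruhatLE cs u u := bruhatLE_iff_chain.2 .refl

theorem BruhatLE.trans {u v w : W} (h : BruhatLE cs u v) (h' : BruhatLE cs v w) :
    BruhatLE cs u w :=
  bruhatLE_iff_chain.2 ((bruhatLE_iff_chain.1 h).trans (bruhatLE_iff_chain.1 h'))

theorem BruhatLE.length_le {u v : W} (h : BruhatLE cs u v) : cs.length u ≤ cs.length v := by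
  obtain ⟨ω, ω', hω, rfl, hω', rfl, hs⟩ := h
  rw [hω.eq, hω'.eq]
  exact hs.length_le

theorem BruhatLE.antisymm {u v : W} (h : BruhatLE cs u v) (h' : BruhatLE cs v u) : u = v := by
  have hl := h'.length_le
  obtain ⟨ω, ω', hω, rfl, hω', rfl, hs⟩ := h
  rw [hω.eq, hω'.eq] at hl
  rw [hs.eq_of_length_le hl]

theorem one_bruhatLE (u : W) : BruhatLE cs 1 u := by
  obtain ⟨ω, hω, rfl⟩ := cs.exists_isReduced u
  exact ⟨ω, [], hω, rfl, by simp [CoxeterSystem.IsReduced], by simp, List.nil_sublist _⟩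

theorem bruhatLE_one {u : W} (h : BruhatLE cs u 1) : u = 1 := h.antisymm (one_bruhatLE u)

theorem BruhatLE.inv {u v : W} (h : BruhatLE cs u v) : BruhatLE cs u⁻¹ v⁻¹ := by
  obtain ⟨ω, ω', hω, rfl, hω', rfl, hs⟩ := h
  exact ⟨ω.reverse, ω'.reverse, hω.reverse, by simp, hω'.reverse, by simp, hs.reverse⟩

theorem bruhatLE_inv_iff {u v : W} : BruhatLE cs u⁻¹ v⁻¹ ↔ BruhatLE cs u v :=
  ⟨fun h => by simpa using h.inv, BruhatLE.inv⟩

theorem BruhatLE.mul_simple {c d : W} (h : BruhatLE cs c d) (i : B) :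
    BruhatLE cs (c * cs.simple i) d ∨ BruhatLE cs (c * cs.simple i) (d * cs.simple i) := by
  refine (chain_simple_mul (bruhatLE_iff_chain.1 h.inv) i).imp (fun h => ?_) fun h => ?_ <;>
  simpa using (bruhatLE_iff_chain.2 h).inv

theorem BruhatLE.mul_simple' {c d : W} (h : BruhatLE cs c d) (i : B) :
    BruhatLE cs c (d * cs.simple i) ∨ BruhatLE cs (c * cs.simple i) (d * cs.simple i) := by
  refine (chain_simple_mul' (bruhatLE_iff_chain.1 h.inv) i).imp (fun h => ?_) fun h => ?_ <;>
  simpa using (bruhatLE_iff_chain.2 h).inv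

theorem bruhatLE_mul_simple_total (u : W) (i : B) :
    BruhatLE cs u (u * cs.simple i) ∨ BruhatLE cs (u * cs.simple i) u := by
  rcases lt_or_gt_of_ne (cs.length_mul_simple_ne u i) with hl | hl
  · right
    have : BruhatStep cs (cs.simple i * u⁻¹) (cs.simple i * (cs.simple i * u⁻¹)) := by
      apply BruhatStep.simple_mul
      rw [← cs.length_inv, ← cs.length_inv (cs.simple i * _)]
      simpa using hl
    simpa using (bruhatLE_iff_chain.2 (.single this)).inv
  · left
    have : BruhatStep cs u⁻¹ (cs.simple i * u⁻¹) := by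
      apply BruhatStep.simple_mul
      rw [← cs.length_inv, ← cs.length_inv (cs.simple i * _)]
      simpa using hl
    simpa using (bruhatLE_iff_chain.2 (.single this)).inv

end Bruhat

/-! ### Minimal and maximal representatives of parabolic cosets. -/

section Parabolic

variable {B W : Type*} [Group W] {M : CoxeterMatrix B} {cs : CoxeterSystem M W} {J : Set B}

theorem simple_mem_parabolic {i : B} (hi : i ∈ J) : cs.simple i ∈ parabolic cs J :=
  Subgroup.subset_closure ⟨i, hi, rfl⟩

theorem parabolic_induction {p : W → Prop} (one : p 1)
    (mul : ∀ z i, i ∈ J → p z → p (z * cs.simple i)) {z : W} (hz : z ∈ parabolic cs J) :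
    p z := by
  induction hz using Subgroup.closure_induction_right with
  | one => exact one
  | mul_right x hx y hy ih =>
    obtain ⟨i, hi, rfl⟩ := hy
    exact mul x i hi ih
  | mul_inv_cancel x hx y hy ih =>
    obtain ⟨i, hi, rfl⟩ := hy
    rw [cs.inv_simple]
    exact mul x i hi ih

theorem mem_minReps_right {u : W} :
    u ∈ minReps cs ∅ J ↔ ∀ z ∈ parabolic cs J, BruhatLE cs u (u * z) := by
  simp [minReps, parabolic]

theorem mem_minReps_left {u : W} :
    u ∈ minReps cs J ∅ ↔ ∀ z ∈ parabolic cs J, BruhatLE cs u (z * u) := by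
  simp [minReps, parabolic]

theorem mem_minReps_left_iff_inv {u : W} : u ∈ minReps cs J ∅ ↔ u⁻¹ ∈ minReps cs ∅ J := by
  rw [mem_minReps_left, mem_minReps_right]
  constructor <;> intro h z hz <;> have := h z⁻¹ (inv_mem hz) <;>
    rw [← bruhatLE_inv_iff] <;> simpa using this

/-- Append the letters of `z` one at a time: lifting gives either `x ≤ v z s` or `x ≤ x s ≤ v z s`.
-/
theorem bruhatLE_mul_of_forall_simple {x v z : W}
    (hx : ∀ i ∈ J, BruhatLE cs x (x * cs.simple i)) (h : BruhatLE cs x v)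
    (hz : z ∈ parabolic cs J) : BruhatLE cs x (v * z) := by
  refine parabolic_induction (p := fun z => BruhatLE cs x (v * z)) (by simpa using h) ?_ hz
  · intro z i hi ih
    rw [← mul_assoc]
    rcases ih.mul_simple' i with h' | h'
    · exact h'
    · exact (hx i hi).trans h'

theorem mem_minReps_right_of_forall_simple {x : W}
    (hx : ∀ i ∈ J, BruhatLE cs x (x * cs.simple i)) : x ∈ minReps cs ∅ J :=
  mem_minReps_right.2 fun _ hz => bruhatLE_mul_of_forall_simple hx (.refl x) hz

/-- An element below `v` and minimal in its coset `x W_J` is below all of `v W_J`. -/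
theorem BruhatLE.le_mul {x v z : W} (h : BruhatLE cs x v) (hx : x ∈ minReps cs ∅ J)
    (hz : z ∈ parabolic cs J) : BruhatLE cs x (v * z) :=
  bruhatLE_mul_of_forall_simple
    (fun _ hi => mem_minReps_right.1 hx _ (simple_mem_parabolic hi)) h hz

theorem BruhatLE.le_left_mul {x v z : W} (h : BruhatLE cs x v) (hx : x ∈ minReps cs J ∅)
    (hz : z ∈ parabolic cs J) : BruhatLE cs x (z * v) := by
  have := h.inv.le_mul (mem_minReps_left_iff_inv.1 hx) (inv_mem hz)
  rw [← bruhatLE_inv_iff]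
  simpa using this

theorem exists_minRep (u : W) (J : Set B) :
    ∃ z ∈ parabolic cs J, u * z ∈ minReps cs ∅ J := by
  classical
  -- An element of least length in the coset goes up under every generator in `J`, which suffices
  -- for minimality.
  have hex : ∃ n, ∃ z ∈ parabolic cs J, cs.length (u * z) = n := ⟨_, 1, one_mem _, rfl⟩
  obtain ⟨z, hz, hn⟩ := Nat.find_spec hex
  refine ⟨z, hz, mem_minReps_right_of_forall_simple fun i hi => ?_⟩
  refine (bruhatLE_mul_simple_total (u * z) i).resolve_right fun h => ?_
  have h1 := h.length_le
  have h2 := cs.length_mul_simple_ne (u * z) i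
  refine Nat.find_min hex (m := cs.length (u * z * cs.simple i)) (by omega)
    ⟨z * cs.simple i, mul_mem hz (simple_mem_parabolic hi), by rw [mul_assoc]⟩

/-- The minimum of the coset `u W_J`. -/
noncomputable def minRep (cs : CoxeterSystem M W) (J : Set B) (u : W) : W :=
  u * (exists_minRep (cs := cs) u J).choose

theorem minRep_mem (J : Set B) (u : W) : minRep cs J u ∈ minReps cs ∅ J :=
  (exists_minRep (cs := cs) u J).choose_spec.2

theorem exists_minRep_eq (J : Set B) (u : W) : ∃ z ∈ parabolic cs J, minRep cs J u = u * z :=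
  ⟨_, (exists_minRep (cs := cs) u J).choose_spec.1, rfl⟩

theorem minRep_bruhatLE (J : Set B) (u : W) : BruhatLE cs (minRep cs J u) u := by
  obtain ⟨z, hz, h⟩ := exists_minRep_eq (cs := cs) J u
  have := (BruhatLE.refl (minRep cs J u)).le_mul (minRep_mem J u) (inv_mem hz)
  rwa [h, mul_inv_cancel_right, ← h] at this

theorem eq_of_mem_minReps_right {u v z : W} (hu : u ∈ minReps cs ∅ J) (hv : v ∈ minReps cs ∅ J)
    (hz : z ∈ parabolic cs J) (h : v = u * z) : u = v := by
  refine (h ▸ mem_minReps_right.1 hu z hz).antisymm ?_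
  have := mem_minReps_right.1 hv z⁻¹ (inv_mem hz)
  rwa [h, mul_inv_cancel_right, ← h] at this

theorem eq_of_mem_minReps_left {u v z : W} (hu : u ∈ minReps cs J ∅) (hv : v ∈ minReps cs J ∅)
    (hz : z ∈ parabolic cs J) (h : v = z * u) : u = v :=
  inv_injective (eq_of_mem_minReps_right (mem_minReps_left_iff_inv.1 hu)
    (mem_minReps_left_iff_inv.1 hv) (inv_mem hz) (by rw [h, mul_inv_rev]))

/-- The minimum of the coset `W_J u`. -/
noncomputable def minRepL (cs : CoxeterSystem M W) (J : Set B) (u : W) : W := (minRep cs J u⁻¹)⁻¹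

theorem minRepL_mem (J : Set B) (u : W) : minRepL cs J u ∈ minReps cs J ∅ := by
  rw [mem_minReps_left_iff_inv, minRepL, inv_inv]
  exact minRep_mem J u⁻¹

theorem exists_minRepL_eq (J : Set B) (u : W) :
    ∃ z ∈ parabolic cs J, minRepL cs J u = z⁻¹ * u := by
  obtain ⟨z, hz, h⟩ := exists_minRep_eq (cs := cs) J u⁻¹
  exact ⟨z, hz, by rw [minRepL, h, mul_inv_rev, inv_inv]⟩

theorem minRepL_bruhatLE (J : Set B) (u : W) : BruhatLE cs (minRepL cs J u) u := by
  rw [← bruhatLE_inv_iff, minRepL, inv_inv]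
  exact minRep_bruhatLE J u⁻¹

/-- The coset `u W_J` has an element `u z` such that everything below it remains below it after
right multiplication by elements of `W_J`. -/
theorem exists_maxRep [Finite W] (u : W) (J : Set B) :
    ∃ z ∈ parabolic cs J, ∀ x, BruhatLE cs x (u * z) → ∀ z' ∈ parabolic cs J,
      BruhatLE cs (x * z') (u * z) := by
  obtain ⟨⟨z, hz⟩, hmax⟩ :=
    Finite.exists_max fun z : parabolic cs J => cs.length (u * (z : W))
  refine ⟨z, hz, fun x hx z' hz' => ?_⟩
  refine parabolic_induction (p := fun z' => BruhatLE cs (x * z') (u * z)) (by simpa using hx) ?_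
    hz'
  · intro z' i hi ih
    rw [← mul_assoc]
    rcases ih.mul_simple i with h | h
    · exact h
    -- `u z` has maximal length in its coset, so every generator in `J` moves it down.
    · refine h.trans ((bruhatLE_mul_simple_total (u * z) i).resolve_left fun h' => ?_)
      have h1 := hmax ⟨z * cs.simple i, mul_mem hz (simple_mem_parabolic hi)⟩
      have h2 := h'.length_le
      have h3 := cs.length_mul_simple_ne (u * z) i
      simp only [← mul_assoc] at h1
      omega

/-- The maximum of the coset `u W_J`. -/
noncomputable def maxRep [Finite W] (cs : CoxeterSystem M W) (J : Set B) (u : W) : W :=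
  u * (exists_maxRep (cs := cs) u J).choose

theorem exists_maxRep_eq [Finite W] (J : Set B) (u : W) :
    ∃ z ∈ parabolic cs J, maxRep cs J u = u * z :=
  ⟨_, (exists_maxRep (cs := cs) u J).choose_spec.1, rfl⟩

theorem BruhatLE.mul_le_maxRep [Finite W] {x u z : W} (h : BruhatLE cs x (maxRep cs J u))
    (hz : z ∈ parabolic cs J) : BruhatLE cs (x * z) (maxRep cs J u) :=
  (exists_maxRep (cs := cs) u J).choose_spec.2 x h z hz

theorem mul_le_maxRep [Finite W] (u : W) {z : W} (hz : z ∈ parabolic cs J) :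
    BruhatLE cs (u * z) (maxRep cs J u) := by
  obtain ⟨z', hz', h⟩ := exists_maxRep_eq (cs := cs) J u
  have := (BruhatLE.refl (maxRep cs J u)).mul_le_maxRep (mul_mem (inv_mem hz') hz)
  nth_rw 1 [h] at this
  rwa [mul_assoc, mul_inv_cancel_left] at this

theorem parabolic_univ : parabolic cs Set.univ = ⊤ := by
  rw [parabolic, Set.image_univ, cs.subgroup_closure_range_simple]

/-- A finite Coxeter group has a greatest element. -/
theorem exists_bruhat_top [Finite W] (cs : CoxeterSystem M W) : ∃ w, ∀ u, BruhatLE cs u w :=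
  ⟨maxRep cs Set.univ 1, fun u => by
    simpa using mul_le_maxRep (cs := cs) (J := Set.univ) 1 (z := u) (by simp [parabolic_univ])⟩

end Parabolic

end RennerCoxeter

/-! ### Standard triples, their order, and monotonicity of extremal elements. -/

namespace RennerCoxeter

namespace RennerCoxeterSystem

variable {R : Type*} [Monoid R] {B : Type*} {M : CoxeterMatrix B} (sys : RennerCoxeterSystem R M)

/-- The centralizer `W(e) = W_{λ(e)}`. -/
abbrev cent (e : R) : Subgroup Rˣ := parabolic sys.cs (typeMap sys.cs e)

/-- The fixer `W_*(e) = W_{λ_*(e)}`. -/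
abbrev fixer (e : R) : Subgroup Rˣ := parabolic sys.cs (lowerType sys.cs e)

variable {sys} {e f : R}

theorem mem_cent (he : e ∈ sys.Lam) {w : Rˣ} : w ∈ sys.cent e ↔ (w : R) * e = e * w := by
  constructor
  · intro hw
    refine parabolic_induction (p := fun w : Rˣ => (w : R) * e = e * w) (by simp) ?_ hw
    intro z i hi ih
    have hi : (sys.cs.simple i : R) * e = e * sys.cs.simple i := hi
    rw [Units.val_mul, mul_assoc, hi, ← mul_assoc, ih, mul_assoc]
  · intro hw
    obtain ⟨I, hI⟩ := sys.centralizer_parabolic e he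
    have hsub : I ⊆ typeMap sys.cs e := fun i hi => (hI _).2 (simple_mem_parabolic hi)
    exact Subgroup.closure_mono (Set.image_mono hsub) ((hI w).1 hw)

theorem mem_fixer (he : e ∈ sys.Lam) {w : Rˣ} :
    w ∈ sys.fixer e ↔ (w : R) * e = e * w ∧ (w : R) * e = e := by
  constructor
  · intro hw
    refine parabolic_induction
      (p := fun w : Rˣ => (w : R) * e = e * w ∧ (w : R) * e = e) (by simp) ?_ hw
    rintro z i ⟨hi, hi'⟩ ⟨ih, ih'⟩
    rw [Units.val_mul, mul_assoc, hi', ih', ← mul_assoc, ← ih, ih', ← hi, hi']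
    exact ⟨rfl, rfl⟩
  · intro hw
    obtain ⟨I, hI⟩ := sys.fixer_parabolic e he
    have hsub : I ⊆ lowerType sys.cs e := fun i hi => (hI _).2 (simple_mem_parabolic hi)
    exact Subgroup.closure_mono (Set.image_mono hsub) ((hI w).1 hw)

theorem fixer_le_cent (he : e ∈ sys.Lam) : sys.fixer e ≤ sys.cent e :=
  fun _ hw => (mem_cent he).2 ((mem_fixer he).1 hw).1

theorem conj_mem_fixer (he : e ∈ sys.Lam) {z q : Rˣ} (hz : z ∈ sys.cent e)
    (hq : q ∈ sys.fixer e) : z⁻¹ * q * z ∈ sys.fixer e := by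
  have hmem := MulMemClass.mul_mem (MulMemClass.mul_mem (inv_mem hz) (fixer_le_cent he hq)) hz
  refine (mem_fixer he).2 ⟨(mem_cent he).1 hmem, ?_⟩
  rw [mem_cent he] at hz
  rw [Units.val_mul, Units.val_mul, mul_assoc, hz, mul_assoc, ← mul_assoc (q : R),
    ((mem_fixer he).1 hq).2, ← hz, Units.inv_mul_cancel_left]

theorem upper_le_cent (e : R) : parabolic sys.cs (upperType sys.cs e) ≤ sys.cent e :=
  Subgroup.closure_mono (Set.image_mono fun _ hi => hi.1)

/-- Every generator in `λ(e)` lies in `λ_*(e)` or `λ^*(e)`, and `W_*(e)` is normal in `W(e)`, so a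
generator in `λ^*(e)` moves left past `q` at the cost of conjugating `q`. -/
theorem exists_upper_mul_fixer (he : e ∈ sys.Lam) {z : Rˣ} (hz : z ∈ sys.cent e) :
    ∃ p ∈ parabolic sys.cs (upperType sys.cs e), ∃ q ∈ sys.fixer e, z = p * q := by
  refine parabolic_induction (p := fun z => ∃ p ∈ parabolic sys.cs (upperType sys.cs e),
    ∃ q ∈ sys.fixer e, z = p * q) ⟨1, one_mem _, 1, one_mem _, by simp⟩ ?_ hz
  rintro _ i hi ⟨p, hp, q, hq, rfl⟩
  by_cases hi' : (sys.cs.simple i : R) * e = e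
  · exact ⟨p, hp, q * sys.cs.simple i, MulMemClass.mul_mem hq (simple_mem_parabolic ⟨hi, hi'⟩), by
      rw [mul_assoc]⟩
  · refine ⟨p * sys.cs.simple i, MulMemClass.mul_mem hp (simple_mem_parabolic ⟨hi, hi'⟩), _,
      conj_mem_fixer he (simple_mem_parabolic hi) hq, ?_⟩
    group

/-- The only entry point of the axiom `λ^*(e) ⊆ λ^*(f)`. With `exists_upper_mul_fixer` it gives
`W(e) ⊆ W(f) W_*(e)`, so elements of `W(e)` can be absorbed in a transition element. -/
theorem upper_mono (he : e ∈ sys.Lam) (hf : f ∈ sys.Lam) (h : IdemLE e f) :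
    parabolic sys.cs (upperType sys.cs e) ≤ sys.cent f :=
  (Subgroup.closure_mono (Set.image_mono (sys.upperType_mono e he f hf h))).trans
    (upper_le_cent f)

theorem fixer_anti (h : IdemLE e f) : sys.fixer f ≤ sys.fixer e := by
  refine Subgroup.closure_mono (Set.image_mono ?_)
  rintro i ⟨hi, hi'⟩
  have h1 : (sys.cs.simple i : R) * e = e := by rw [← h.2, ← mul_assoc, hi']
  refine ⟨?_, h1⟩
  rw [h1]
  nth_rw 2 [← h.1]
  rw [mul_assoc, ← hi, hi', h.1]

variable (sys)

/-- The data `(x, e, y)` of a left standard form `x e y`, or of a right standard form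
`y⁻¹ e x⁻¹`. -/
structure StdTriple where
  x : Rˣ
  e : R
  y : Rˣ
  mem_lam : e ∈ sys.Lam
  x_mem : x ∈ minReps sys.cs ∅ (lowerType sys.cs e)
  y_mem : y ∈ minReps sys.cs (typeMap sys.cs e) ∅

variable {sys}

namespace StdTriple

/-- The adherence order in terms of standard triples. -/
def LE (t t' : sys.StdTriple) : Prop :=
  IdemLE t.e t'.e ∧ ∃ p ∈ sys.cent t'.e, ∃ q ∈ sys.fixer t.e,
    BruhatLE sys.cs t.x (t'.x * (p * q)) ∧ BruhatLE sys.cs ((p * q)⁻¹ * t'.y) t.y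

theorem idemLE_self (t : sys.StdTriple) : IdemLE t.e t.e :=
  ⟨sys.isIdempotentElem_of_mem _ t.mem_lam, sys.isIdempotentElem_of_mem _ t.mem_lam⟩

theorem le_of_bruhatLE {t t' : sys.StdTriple} (he : IdemLE t.e t'.e)
    (hx : BruhatLE sys.cs t.x t'.x) (hy : BruhatLE sys.cs t'.y t.y) : LE t t' :=
  ⟨he, 1, one_mem _, 1, one_mem _, by simpa using hx, by simpa using hy⟩

theorem LE.antisymm {t t' : sys.StdTriple} (h : LE t t') (h' : LE t' t) : t = t' := by
  obtain ⟨x, e, y, he, hx, hy⟩ := t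
  obtain ⟨a, f, b, hf, ha, hb⟩ := t'
  obtain ⟨h1, p, hp, q, hq, hx1, hy1⟩ := h
  obtain ⟨h2, p', hp', q', hq', hx2, hy2⟩ := h'
  dsimp only at *
  obtain rfl : e = f := by
    rw [← h1.1]
    exact h2.2
  have hw := inv_mem (MulMemClass.mul_mem hp (fixer_le_cent he hq))
  have hw' := inv_mem (MulMemClass.mul_mem hp' (fixer_le_cent he hq'))
  -- Since `b` and `y` are minimal in their `W(e)`-cosets, the two inequalities give `b ≤ y ≤ b`;
  -- then `b ≤ w b ≤ b` forces `w = 1`.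
  have key : ∀ {w w' y b : Rˣ}, w ∈ sys.cent e → w' ∈ sys.cent e →
      y ∈ minReps sys.cs (typeMap sys.cs e) ∅ → b ∈ minReps sys.cs (typeMap sys.cs e) ∅ →
      BruhatLE sys.cs (w * b) y → BruhatLE sys.cs (w' * y) b → b = y ∧ w = 1 := by
    intro w w' y b hw hw' hy hb h h'
    have hby := ((BruhatLE.refl b).le_left_mul hb hw).trans h
    have hyb := ((BruhatLE.refl y).le_left_mul hy hw').trans h'
    obtain rfl := hby.antisymm hyb
    exact ⟨rfl, by simpa using h.antisymm ((BruhatLE.refl b).le_left_mul hb hw)⟩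
  obtain ⟨rfl, h3⟩ := key hw hw' hy hb hy1 hy2
  obtain ⟨-, h4⟩ := key hw' hw hb hy hy2 hy1
  rw [inv_eq_one] at h3 h4
  rw [h3, mul_one] at hx1
  rw [h4, mul_one] at hx2
  obtain rfl := hx1.antisymm hx2
  rfl

theorem minReps_cent_subset {e : R} :
    minReps sys.cs ∅ (typeMap sys.cs e) ⊆ minReps sys.cs ∅ (lowerType sys.cs e) := by
  intro u hu
  rw [mem_minReps_right] at hu ⊢
  exact fun z hz => hu z (Subgroup.closure_mono (Set.image_mono fun _ hi => hi.1) hz)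

theorem one_mem_minReps {I J : Set B} : (1 : Rˣ) ∈ minReps sys.cs I J :=
  fun _ _ _ _ => one_bruhatLE _

/-- The factor in `W(f)` is superfluous for the `y`-inequality: `b ≤ p⁻¹ b` by minimality of `b`,
and the minimum of `W_*(e) b` stays below `q⁻¹ p⁻¹ b`. -/
theorem LE.exists_fixer_mul_le {t t' : sys.StdTriple} (h : LE t t') :
    ∃ q ∈ sys.fixer t.e, BruhatLE sys.cs (q⁻¹ * t'.y) t.y := by
  obtain ⟨-, p, hp, q, hq, -, hy⟩ := h
  obtain ⟨z, hz, h'⟩ := exists_minRepL_eq (cs := sys.cs) (lowerType sys.cs t.e) t'.y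
  refine ⟨z, hz, BruhatLE.trans ?_ hy⟩
  rw [← h', mul_inv_rev, mul_assoc]
  exact ((minRepL_bruhatLE _ _).trans
    ((BruhatLE.refl _).le_left_mul t'.y_mem (inv_mem hp))).le_left_mul
    (minRepL_mem _ _) (inv_mem hq)

/-- The least element of `x W(e)`. -/
noncomputable def xMin (t : sys.StdTriple) : Rˣ := minRep sys.cs (typeMap sys.cs t.e) t.x

theorem xMin_le {t : sys.StdTriple} {x : Rˣ} (h : t.x⁻¹ * x ∈ sys.cent t.e) :
    BruhatLE sys.cs t.xMin x := by
  have := (minRep_bruhatLE (cs := sys.cs) (typeMap sys.cs t.e) t.x).le_mul (minRep_mem _ _) h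
  simpa [xMin] using this

theorem inv_mul_xMin_mem (t : sys.StdTriple) : t.x⁻¹ * t.xMin ∈ sys.cent t.e := by
  obtain ⟨z, hz, h⟩ := exists_minRep_eq (cs := sys.cs) (typeMap sys.cs t.e) t.x
  rw [xMin, h]
  simpa using hz

/-- The least element of the `RelY`-class. -/
def minY (t : sys.StdTriple) : sys.StdTriple :=
  ⟨1, t.e, t.y, t.mem_lam, one_mem_minReps, t.y_mem⟩

theorem minY_mono {t t' : sys.StdTriple} (h : LE t t') : LE t.minY t'.minY := by
  obtain ⟨q, hq, hy⟩ := h.exists_fixer_mul_le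
  exact ⟨h.1, 1, one_mem _, q, hq, one_bruhatLE _, by simpa [minY] using hy⟩

section Finite

variable [Finite Rˣ]

/-- The `x`-part of the greatest element of the coset `x W(e)`, reduced modulo `W_*(e)`. -/
noncomputable def xMax (t : sys.StdTriple) : Rˣ :=
  minRep sys.cs (lowerType sys.cs t.e) (maxRep sys.cs (typeMap sys.cs t.e) t.x)

/-- The greatest element of `W^{λ_*(e)}`. -/
noncomputable def xTop (t : sys.StdTriple) : Rˣ :=
  minRep sys.cs (lowerType sys.cs t.e) (exists_bruhat_top sys.cs).choose

/-- The greatest element of `^{λ(e)}W`. -/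
noncomputable def yTop (t : sys.StdTriple) : Rˣ :=
  minRepL sys.cs (typeMap sys.cs t.e) (exists_bruhat_top sys.cs).choose

theorem le_xTop (t : sys.StdTriple) {x : Rˣ} (hx : x ∈ minReps sys.cs ∅ (lowerType sys.cs t.e)) :
    BruhatLE sys.cs x t.xTop := by
  obtain ⟨z, hz, h⟩ := exists_minRep_eq (cs := sys.cs) (lowerType sys.cs t.e)
    (exists_bruhat_top sys.cs).choose
  rw [xTop, h]
  exact ((exists_bruhat_top sys.cs).choose_spec x).le_mul hx hz

theorem le_yTop (t : sys.StdTriple) {y : Rˣ} (hy : y ∈ minReps sys.cs (typeMap sys.cs t.e) ∅) :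
    BruhatLE sys.cs y t.yTop := by
  obtain ⟨z, hz, h⟩ := exists_minRepL_eq (cs := sys.cs) (typeMap sys.cs t.e)
    (exists_bruhat_top sys.cs).choose
  rw [yTop, h]
  exact ((exists_bruhat_top sys.cs).choose_spec y).le_left_mul hy (inv_mem hz)

theorem le_xMax {t : sys.StdTriple} {x : Rˣ} (hx : x ∈ minReps sys.cs ∅ (lowerType sys.cs t.e))
    (h : t.x⁻¹ * x ∈ sys.cent t.e) : BruhatLE sys.cs x t.xMax := by
  obtain ⟨z, hz, h'⟩ := exists_minRep_eq (cs := sys.cs) (lowerType sys.cs t.e)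
    (maxRep sys.cs (typeMap sys.cs t.e) t.x)
  rw [xMax, h']
  refine BruhatLE.le_mul ?_ hx hz
  simpa using mul_le_maxRep t.x h

theorem inv_mul_xMax_mem (t : sys.StdTriple) : t.x⁻¹ * t.xMax ∈ sys.cent t.e := by
  obtain ⟨z, hz, h⟩ := exists_minRep_eq (cs := sys.cs) (lowerType sys.cs t.e)
    (maxRep sys.cs (typeMap sys.cs t.e) t.x)
  obtain ⟨z', hz', h'⟩ := exists_maxRep_eq (cs := sys.cs) (typeMap sys.cs t.e) t.x
  rw [xMax, h, h']
  simpa [mul_assoc] using MulMemClass.mul_mem hz' (fixer_le_cent t.mem_lam hz)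

theorem LE.x_le_maxRep {t t' : sys.StdTriple} (h : LE t t') :
    BruhatLE sys.cs t.x (maxRep sys.cs (typeMap sys.cs t'.e) t'.x) := by
  obtain ⟨-, p, hp, q, hq, hx, -⟩ := h
  have := hx.le_mul t.x_mem (inv_mem hq)
  rw [← mul_assoc, mul_inv_cancel_right] at this
  exact this.trans (mul_le_maxRep t'.x hp)

/-- Write the maximum of `x W(e)` as `x p q'` with `p ∈ W_{λ^*(e)} ⊆ W(f)`. Then `xMax ≤ x p`, which
is below the maximum of `a W(f)`. The remaining right factors lie in `W_*(e)`, modulo which `xMax`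
is minimal. -/
theorem LE.xMax_le {t t' : sys.StdTriple} (h : LE t t') {q : Rˣ} (hq : q ∈ sys.fixer t.e) :
    BruhatLE sys.cs t.xMax (t'.xMax * q) := by
  obtain ⟨z, hz, h1⟩ := exists_maxRep_eq (cs := sys.cs) (typeMap sys.cs t.e) t.x
  obtain ⟨p, hp, q', hq', rfl⟩ := exists_upper_mul_fixer t.mem_lam hz
  have h2 := h.x_le_maxRep.mul_le_maxRep (upper_mono t.mem_lam t'.mem_lam h.1 hp)
  have h3 := (minRep_bruhatLE (cs := sys.cs) (lowerType sys.cs t.e) (t.x * (p * q'))).le_mul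
    (minRep_mem _ _) (inv_mem hq')
  rw [← mul_assoc, mul_inv_cancel_right, mul_assoc, ← h1] at h3
  obtain ⟨q'', hq'', h4⟩ := exists_minRep_eq (cs := sys.cs) (lowerType sys.cs t'.e)
    (maxRep sys.cs (typeMap sys.cs t'.e) t'.x)
  rw [xMax, xMax, h4, mul_assoc]
  exact (h3.trans h2).le_mul (minRep_mem _ _) (MulMemClass.mul_mem (fixer_anti h.1 hq'') hq)

theorem xTop_le {t t' : sys.StdTriple} (h : IdemLE t.e t'.e) {q : Rˣ} (hq : q ∈ sys.fixer t.e) :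
    BruhatLE sys.cs t.xTop (t'.xTop * q) := by
  obtain ⟨q', hq', h'⟩ := exists_minRep_eq (cs := sys.cs) (lowerType sys.cs t'.e)
    (exists_bruhat_top sys.cs).choose
  rw [xTop, xTop, h', mul_assoc]
  exact (minRep_bruhatLE _ _).le_mul (minRep_mem _ _) (MulMemClass.mul_mem (fixer_anti h hq') hq)

/-- Any `z ∈ W(f)` can be corrected by some `z' ∈ W(e)` making `(z z')⁻¹ yTop'` minimal in its
`W(e)`-coset, hence below `yTop`. -/
theorem exists_yTop_le {t t' : sys.StdTriple} (h : IdemLE t.e t'.e) (z : Rˣ)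
    (hz : z ∈ sys.cent t'.e) :
    ∃ z' ∈ sys.cent t.e, ∃ p ∈ sys.cent t'.e, ∃ q ∈ sys.fixer t.e, z * z' = p * q ∧
      BruhatLE sys.cs ((z * z')⁻¹ * t'.yTop) t.yTop := by
  obtain ⟨z', hz', h'⟩ := exists_minRepL_eq (cs := sys.cs) (typeMap sys.cs t.e) (z⁻¹ * t'.yTop)
  obtain ⟨p, hp, q, hq, rfl⟩ := exists_upper_mul_fixer t.mem_lam hz'
  refine ⟨_, hz', z * p, MulMemClass.mul_mem hz (upper_mono t.mem_lam t'.mem_lam h hp), q, hq,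
    (mul_assoc _ _ _).symm, t.le_yTop ?_⟩
  rw [mul_inv_rev, mul_assoc, ← h']
  exact minRepL_mem _ _

theorem LE.exists_xMin_yTop_le {t t' : sys.StdTriple} (h : LE t t') :
    ∃ p ∈ sys.cent t'.e, ∃ q ∈ sys.fixer t.e, BruhatLE sys.cs t.xMin (t'.xMin * (p * q)) ∧
      BruhatLE sys.cs ((p * q)⁻¹ * t'.yTop) t.yTop := by
  obtain ⟨z, hz, h1⟩ := exists_maxRep_eq (cs := sys.cs) (typeMap sys.cs t'.e) t'.x
  obtain ⟨z₂, hz₂, h2⟩ := exists_minRep_eq (cs := sys.cs) (typeMap sys.cs t'.e) t'.x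
  -- `z₂⁻¹ z` carries the minimum of `a W(f)` to its maximum; the correction `z'` is harmless on the
  -- `x`-side because `xMin` is minimal modulo `W(e)`.
  obtain ⟨z', hz', p, hp, q, hq, h3, h4⟩ := exists_yTop_le h.1 (z₂⁻¹ * z)
    (MulMemClass.mul_mem (inv_mem hz₂) hz)
  rw [h3] at h4
  refine ⟨p, hp, q, hq, ?_, h4⟩
  have := ((minRep_bruhatLE _ _).trans h.x_le_maxRep).le_mul
    (minRep_mem (typeMap sys.cs t.e) t.x) hz'
  rw [← h3, xMin, xMin, h2, mul_assoc, ← mul_assoc z₂, mul_inv_cancel_left, ← mul_assoc, ← h1]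
  exact this

end Finite

/-! #### The relations on triples corresponding to Green's relations -/

/-- The relation on triples corresponding to `𝓙`. -/
def RelJ (t t' : sys.StdTriple) : Prop := t.e = t'.e

/-- Equality of `e` and `y`: this is `𝓛` for left and `𝓡` for right standard forms. -/
def RelY (t t' : sys.StdTriple) : Prop := t.e = t'.e ∧ t.y = t'.y

/-- Equality of `e` and `x W(e)`: this is `𝓡` for left and `𝓛` for right standard forms. -/
def RelX (t t' : sys.StdTriple) : Prop := t.e = t'.e ∧ t.x⁻¹ * t'.x ∈ sys.cent t.e

/-- The relation on triples corresponding to `𝓗`. -/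
def RelH (t t' : sys.StdTriple) : Prop := RelY t t' ∧ RelX t t'

/-- `mn` chooses the least and `mx` the greatest element of each class of `rel`, and `mx` is
monotone. -/
structure HasExtrema (rel : sys.StdTriple → sys.StdTriple → Prop)
    (mn mx : sys.StdTriple → sys.StdTriple) : Prop where
  rel_mn : ∀ t, rel t (mn t)
  rel_mx : ∀ t, rel t (mx t)
  mn_le : ∀ t t', rel t t' → LE (mn t) t'
  le_mx : ∀ t t', rel t t' → LE t' (mx t)
  mx_mono : ∀ t t', LE t t' → LE (mx t) (mx t')

variable [Finite Rˣ]

/-- The least element of the `RelH`-class. -/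
noncomputable def minH (t : sys.StdTriple) : sys.StdTriple :=
  ⟨t.xMin, t.e, t.y, t.mem_lam, minReps_cent_subset (minRep_mem _ _), t.y_mem⟩

/-- The greatest element of the `RelH`-class. -/
noncomputable def maxH (t : sys.StdTriple) : sys.StdTriple :=
  ⟨t.xMax, t.e, t.y, t.mem_lam, minRep_mem _ _, t.y_mem⟩

/-- The least element of the `RelX`-class. -/
noncomputable def minX (t : sys.StdTriple) : sys.StdTriple :=
  ⟨t.xMin, t.e, t.yTop, t.mem_lam, minReps_cent_subset (minRep_mem _ _), minRepL_mem _ _⟩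

/-- The greatest element of the `RelX`-class. -/
noncomputable def maxX (t : sys.StdTriple) : sys.StdTriple :=
  ⟨t.xMax, t.e, 1, t.mem_lam, minRep_mem _ _, one_mem_minReps⟩

/-- The greatest element of the `RelY`-class. -/
noncomputable def maxY (t : sys.StdTriple) : sys.StdTriple :=
  ⟨t.xTop, t.e, t.y, t.mem_lam, minRep_mem _ _, t.y_mem⟩

/-- The least element of the `RelJ`-class. -/
noncomputable def minJ (t : sys.StdTriple) : sys.StdTriple :=
  ⟨1, t.e, t.yTop, t.mem_lam, one_mem_minReps, minRepL_mem _ _⟩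

/-- The greatest element of the `RelJ`-class. -/
noncomputable def maxJ (t : sys.StdTriple) : sys.StdTriple :=
  ⟨t.xTop, t.e, 1, t.mem_lam, minRep_mem _ _, one_mem_minReps⟩

theorem hasExtrema_relH : HasExtrema (sys := sys) RelH minH maxH where
  rel_mn t := ⟨⟨rfl, rfl⟩, rfl, inv_mul_xMin_mem t⟩
  rel_mx t := ⟨⟨rfl, rfl⟩, rfl, inv_mul_xMax_mem t⟩
  mn_le t t' h := le_of_bruhatLE (h.2.1 ▸ t.idemLE_self) (xMin_le h.2.2) (h.1.2 ▸ .refl _)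
  le_mx t t' h := le_of_bruhatLE (h.2.1 ▸ t.idemLE_self)
    (le_xMax (h.2.1 ▸ t'.x_mem) h.2.2) (h.1.2 ▸ .refl _)
  mx_mono t t' h := by
    obtain ⟨q, hq, hy⟩ := h.exists_fixer_mul_le
    exact ⟨h.1, 1, one_mem _, q, hq, by simpa [maxH] using h.xMax_le hq, by simpa [maxH, maxY] using hy⟩

theorem hasExtrema_relX : HasExtrema (sys := sys) RelX minX maxX where
  rel_mn t := ⟨rfl, inv_mul_xMin_mem t⟩
  rel_mx t := ⟨rfl, inv_mul_xMax_mem t⟩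
  mn_le t t' h := le_of_bruhatLE (h.1 ▸ t.idemLE_self) (xMin_le h.2) (t.le_yTop (h.1 ▸ t'.y_mem))
  le_mx t t' h := le_of_bruhatLE (h.1 ▸ t.idemLE_self)
    (le_xMax (h.1 ▸ t'.x_mem) h.2) (one_bruhatLE _)
  mx_mono t t' h := le_of_bruhatLE h.1 (by simpa [maxX] using h.xMax_le (one_mem _)) (.refl _)

theorem hasExtrema_relY : HasExtrema (sys := sys) RelY minY maxY where
  rel_mn t := ⟨rfl, rfl⟩
  rel_mx t := ⟨rfl, rfl⟩
  mn_le t t' h := le_of_bruhatLE (h.1 ▸ t.idemLE_self) (one_bruhatLE _) (h.2 ▸ .refl _)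
  le_mx t t' h := le_of_bruhatLE (h.1 ▸ t.idemLE_self) (t.le_xTop (h.1 ▸ t'.x_mem))
    (h.2 ▸ .refl _)
  mx_mono t t' h := by
    obtain ⟨q, hq, hy⟩ := h.exists_fixer_mul_le
    exact ⟨h.1, 1, one_mem _, q, hq, by simpa [maxY] using xTop_le h.1 hq, by simpa [maxH, maxY] using hy⟩

theorem hasExtrema_relJ : HasExtrema (sys := sys) RelJ minJ maxJ where
  rel_mn t := rfl
  rel_mx t := rfl
  mn_le t t' h := le_of_bruhatLE (h ▸ t.idemLE_self) (one_bruhatLE _)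
    (t.le_yTop (h ▸ t'.y_mem))
  le_mx t t' h := le_of_bruhatLE (h ▸ t.idemLE_self) (t.le_xTop (h ▸ t'.x_mem))
    (one_bruhatLE _)
  mx_mono t t' h := le_of_bruhatLE h.1 (by simpa [maxJ] using xTop_le h.1 (one_mem _)) (.refl _)

theorem minX_mono {t t' : sys.StdTriple} (h : LE t t') : LE t.minX t'.minX :=
  ⟨h.1, h.exists_xMin_yTop_le⟩

theorem minJ_mono {t t' : sys.StdTriple} (h : LE t t') : LE t.minJ t'.minJ := by
  obtain ⟨z, -, p, hp, q, hq, h1, h2⟩ := exists_yTop_le h.1 1 (one_mem _)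
  exact ⟨h.1, p, hp, q, hq, one_bruhatLE _, h1 ▸ h2⟩

end StdTriple

end RennerCoxeterSystem

end RennerCoxeter

/-! ### Green's relations in a factorizable monoid and on standard forms. -/

namespace RennerCoxeter

section Green

variable {R : Type*} [Monoid R]

theorem greenL_iff {r s : R} : greenL r s ↔ (∃ c, r = c * s) ∧ ∃ d, s = d * r := by
  constructor
  · intro h
    have h1 : r ∈ {t : R | ∃ a, t = a * r} := ⟨1, by simp⟩
    have h2 : s ∈ {t : R | ∃ a, t = a * s} := ⟨1, by simp⟩
    rw [greenL] at h
    exact ⟨by rwa [h] at h1, by rwa [← h] at h2⟩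
  · rintro ⟨⟨c, hc⟩, d, hd⟩
    ext t
    constructor
    · rintro ⟨a, rfl⟩
      exact ⟨a * c, by rw [mul_assoc, ← hc]⟩
    · rintro ⟨a, rfl⟩
      exact ⟨a * d, by rw [mul_assoc, ← hd]⟩

theorem greenR_iff {r s : R} : greenR r s ↔ (∃ c, r = s * c) ∧ ∃ d, s = r * d := by
  constructor
  · intro h
    have h1 : r ∈ {t : R | ∃ a, t = r * a} := ⟨1, by simp⟩
    have h2 : s ∈ {t : R | ∃ a, t = s * a} := ⟨1, by simp⟩
    rw [greenR] at h
    exact ⟨by rwa [h] at h1, by rwa [← h] at h2⟩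
  · rintro ⟨⟨c, hc⟩, d, hd⟩
    ext t
    constructor
    · rintro ⟨a, rfl⟩
      exact ⟨c * a, by rw [← mul_assoc, ← hc]⟩
    · rintro ⟨a, rfl⟩
      exact ⟨d * a, by rw [← mul_assoc, ← hd]⟩

theorem greenJ_iff {r s : R} :
    greenJ r s ↔ (∃ c c', r = c * s * c') ∧ ∃ d d', s = d * r * d' := by
  constructor
  · intro h
    have h1 : r ∈ {t : R | ∃ a b, t = a * r * b} := ⟨1, 1, by simp⟩
    have h2 : s ∈ {t : R | ∃ a b, t = a * s * b} := ⟨1, 1, by simp⟩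
    rw [greenJ] at h
    exact ⟨by rwa [h] at h1, by rwa [← h] at h2⟩
  · rintro ⟨⟨c, c', hc⟩, d, d', hd⟩
    ext t
    constructor
    · rintro ⟨a, b, rfl⟩
      refine ⟨a * c, c' * b, ?_⟩
      nth_rw 1 [hc]
      simp only [mul_assoc]
    · rintro ⟨a, b, rfl⟩
      refine ⟨a * d, d' * b, ?_⟩
      nth_rw 1 [hd]
      simp only [mul_assoc]

theorem equivalence_greenJ : Equivalence (greenJ (R := R)) :=
  ⟨fun _ => rfl, fun h => Eq.symm h, fun h h' => Eq.trans h h'⟩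

theorem equivalence_greenL : Equivalence (greenL (R := R)) :=
  ⟨fun _ => rfl, fun h => Eq.symm h, fun h h' => Eq.trans h h'⟩

theorem equivalence_greenR : Equivalence (greenR (R := R)) :=
  ⟨fun _ => rfl, fun h => Eq.symm h, fun h h' => Eq.trans h h'⟩

theorem equivalence_greenH : Equivalence (greenH (R := R)) :=
  ⟨fun _ => ⟨rfl, rfl⟩, fun h => ⟨h.1.symm, h.2.symm⟩,
    fun h h' => ⟨h.1.trans h'.1, h.2.trans h'.2⟩⟩

theorem isIdempotentElem_conj {e : R} (he : IsIdempotentElem e) (u : Rˣ) :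
    IsIdempotentElem (((u⁻¹ : Rˣ) : R) * e * u) := by
  rw [IsIdempotentElem, mul_assoc, mul_assoc, ← mul_assoc (u : R), Units.mul_inv_cancel_left,
    ← mul_assoc e, he.eq, mul_assoc]

/-- Iterating `e ≤ z⁻¹ e z` gives `e ≤ z⁻ⁿ e zⁿ` for all `n`. As `z` has finite order, some `zⁿ` is
`z⁻¹`, which yields the reverse inequality. -/
theorem IsFactorizable.conj_eq_of_mul_eq [Finite Rˣ] (hR : IsFactorizable R) {e : R}
    (he : IsIdempotentElem e) {z : Rˣ} (h : e * (((z⁻¹ : Rˣ) : R) * e * z) = e) :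
    ((z⁻¹ : Rˣ) : R) * e * z = e := by
  have key : ∀ n : ℕ, e * ((((z ^ n)⁻¹ : Rˣ) : R) * e * (z ^ n : Rˣ)) = e := by
    intro n
    induction n with
    | zero => simpa using he.eq
    | succ n ih =>
      have h1 : ((((z ^ n)⁻¹ : Rˣ) : R) * e * (z ^ n : Rˣ)) *
          ((((z ^ (n + 1))⁻¹ : Rˣ) : R) * e * (z ^ (n + 1) : Rˣ)) =
          (((z ^ n)⁻¹ : Rˣ) : R) * (e * (((z⁻¹ : Rˣ) : R) * e * z)) * (z ^ n : Rˣ) := by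
        rw [pow_succ' z n, mul_inv_rev]
        simp only [Units.val_mul, mul_assoc, Units.mul_inv_cancel_left]
      rw [h] at h1
      nth_rw 1 [← ih]
      rw [mul_assoc, h1, ih]
  obtain ⟨n, hn⟩ := Nat.exists_eq_succ_of_ne_zero (orderOf_pos z).ne'
  have hz : z ^ n = z⁻¹ := by
    rw [eq_inv_iff_mul_eq_one, ← pow_succ, ← Nat.succ_eq_add_one, ← hn, pow_orderOf_eq_one]
  have h2 := key n
  rw [hz, inv_inv] at h2
  have h3 : ((z⁻¹ : Rˣ) : R) * (e * ((z : R) * e * ((z⁻¹ : Rˣ) : R))) * z =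
      ((z⁻¹ : Rˣ) : R) * e * z * e := by simp [mul_assoc]
  rw [h2, hR.idem_comm _ _ (isIdempotentElem_conj he z) he, h] at h3
  exact h3

/-- Write `d = g v` with `g` idempotent. Then `e = c f g v`, and `f g = g f` absorbs a further
factor `f`. -/
theorem IsFactorizable.exists_mul_conj_eq (hR : IsFactorizable R) {e f c d : R}
    (hf : IsIdempotentElem f) (h : e = c * f * d) :
    ∃ v : Rˣ, e * (((v⁻¹ : Rˣ) : R) * f * v) = e := by
  obtain ⟨g, hg, v, rfl⟩ := hR.idem_mul_unit d
  refine ⟨v, ?_⟩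
  rw [h]
  simp only [mul_assoc, Units.mul_inv_cancel_left]
  rw [← mul_assoc g, ← hR.idem_comm f g hf hg, ← mul_assoc f, ← mul_assoc f f, hf.eq, mul_assoc]

end Green

namespace RennerCoxeterSystem

variable {R : Type*} [Monoid R] {B : Type*} {M : CoxeterMatrix B} {sys : RennerCoxeterSystem R M}

theorem eq_of_conj {e f : R} (he : e ∈ sys.Lam) (hf : f ∈ sys.Lam) {z : Rˣ}
    (h : e = ((z⁻¹ : Rˣ) : R) * f * z) : e = f ∧ z ∈ sys.cent e := by
  have hef : e = f := (sys.transversal e (sys.isIdempotentElem_of_mem e he)).unique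
    ⟨he, 1, by simp⟩ ⟨hf, z, by simp [h, mul_assoc]⟩
  subst hef
  refine ⟨rfl, (mem_cent he).2 ?_⟩
  nth_rw 1 [h]
  simp [mul_assoc]

theorem greenL_standard_iff {x y a b : Rˣ} {e f : R} (he : e ∈ sys.Lam) (hf : f ∈ sys.Lam) :
    greenL (x * e * y : R) (a * f * b) ↔ e = f ∧ y * b⁻¹ ∈ sys.cent e := by
  have hei := sys.isIdempotentElem_of_mem e he
  have hfi := sys.isIdempotentElem_of_mem f hf
  rw [greenL_iff]
  constructor
  · rintro ⟨⟨c, hc⟩, d, hd⟩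
    have h1 : e = ((x⁻¹ : Rˣ) : R) * c * a * f * (b * y⁻¹ : Rˣ) := by
      calc e = ((x⁻¹ : Rˣ) : R) * (x * e * y) * (y⁻¹ : Rˣ) := by simp [mul_assoc]
        _ = _ := by rw [hc]; simp [mul_assoc]
    have h2 : f = ((a⁻¹ : Rˣ) : R) * d * x * e * ((b * y⁻¹ : Rˣ)⁻¹ : Rˣ) := by
      calc f = ((a⁻¹ : Rˣ) : R) * (a * f * b) * (b⁻¹ : Rˣ) := by simp [mul_assoc]
        _ = _ := by rw [hd]; simp [mul_assoc]
    -- The same `z` gives `e ≤ z⁻¹ f z` and `f ≤ z e z⁻¹`, hence equality without any finiteness;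
    -- the transversal property finishes.
    generalize hz : b * y⁻¹ = z at h1 h2
    have h3 : e * (((z⁻¹ : Rˣ) : R) * f * z) = e := by
      rw [h1]
      simp only [mul_assoc, Units.mul_inv_cancel_left]
      rw [← mul_assoc f f, hfi.eq]
    have h4 : f * ((z : R) * e * (z⁻¹ : Rˣ)) = f := by
      rw [h2]
      simp only [mul_assoc, Units.inv_mul_cancel_left]
      rw [← mul_assoc e e, hei.eq]
    have h5 : ((z⁻¹ : Rˣ) : R) * f * z * e = ((z⁻¹ : Rˣ) : R) * f * z := by
      nth_rw 2 [← h4]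
      simp [mul_assoc]
    rw [sys.factorizable.idem_comm _ _ (isIdempotentElem_conj hfi z) hei, h3] at h5
    obtain ⟨h6, h7⟩ := eq_of_conj he hf h5
    exact ⟨h6, by simpa [← hz] using inv_mem h7⟩
  · rintro ⟨rfl, h⟩
    have h1 := (mem_cent he).1 h
    have h2 := (mem_cent he).1 (inv_mem h)
    refine ⟨⟨x * (y * b⁻¹ : Rˣ) * (a⁻¹ : Rˣ), ?_⟩, ⟨a * ((y * b⁻¹)⁻¹ : Rˣ) * (x⁻¹ : Rˣ), ?_⟩⟩
    · simp only [mul_assoc, Units.inv_mul_cancel_left]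
      rw [← mul_assoc _ e (b : R), h1]
      simp [mul_assoc]
    · simp only [mul_assoc, Units.inv_mul_cancel_left]
      rw [← mul_assoc _ e (y : R), h2]
      simp [mul_assoc]

theorem greenR_standard_iff {x y a b : Rˣ} {e f : R} (he : e ∈ sys.Lam) (hf : f ∈ sys.Lam) :
    greenR (x * e * y : R) (a * f * b) ↔ e = f ∧ x⁻¹ * a ∈ sys.cent e := by
  have hei := sys.isIdempotentElem_of_mem e he
  have hfi := sys.isIdempotentElem_of_mem f hf
  rw [greenR_iff]
  constructor
  · rintro ⟨⟨c, hc⟩, d, hd⟩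
    have h1 : e = ((a⁻¹ * x : Rˣ)⁻¹ : Rˣ) * f * (b * c * (y⁻¹ : Rˣ)) := by
      calc e = ((x⁻¹ : Rˣ) : R) * (x * e * y) * (y⁻¹ : Rˣ) := by simp [mul_assoc]
        _ = _ := by rw [hc]; simp [mul_assoc]
    have h2 : f = (a⁻¹ * x : Rˣ) * e * (y * d * (b⁻¹ : Rˣ)) := by
      calc f = ((a⁻¹ : Rˣ) : R) * (a * f * b) * (b⁻¹ : Rˣ) := by simp [mul_assoc]
        _ = _ := by rw [hd]; simp [mul_assoc]
    generalize hz : a⁻¹ * x = z at h1 h2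
    have h3 : (((z⁻¹ : Rˣ) : R) * f * z) * e = e := by
      rw [h1]
      simp only [mul_assoc, Units.mul_inv_cancel_left]
      rw [← mul_assoc f f, hfi.eq]
    have h4 : ((z : R) * e * (z⁻¹ : Rˣ)) * f = f := by
      rw [h2]
      simp only [mul_assoc, Units.inv_mul_cancel_left]
      rw [← mul_assoc e e, hei.eq]
    have h5 : e * (((z⁻¹ : Rˣ) : R) * f * z) = ((z⁻¹ : Rˣ) : R) * f * z := by
      nth_rw 2 [← h4]
      simp [mul_assoc]
    rw [sys.factorizable.idem_comm _ _ hei (isIdempotentElem_conj hfi z), h3] at h5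
    obtain ⟨h6, h7⟩ := eq_of_conj he hf h5
    exact ⟨h6, by simpa [← hz] using inv_mem h7⟩
  · rintro ⟨rfl, h⟩
    have h1 := (mem_cent he).1 h
    have h2 := (mem_cent he).1 (inv_mem h)
    refine ⟨⟨(b⁻¹ : Rˣ) * ((x⁻¹ * a)⁻¹ : Rˣ) * y, ?_⟩, ⟨(y⁻¹ : Rˣ) * (x⁻¹ * a : Rˣ) * b, ?_⟩⟩
    · simp only [mul_assoc, Units.mul_inv_cancel_left]
      rw [← mul_assoc e, ← h2]
      simp [mul_assoc]
    · simp only [mul_assoc, Units.mul_inv_cancel_left]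
      rw [← mul_assoc e, ← h1]
      simp [mul_assoc]

theorem greenJ_standard_iff [Finite Rˣ] {x y a b : Rˣ} {e f : R} (he : e ∈ sys.Lam)
    (hf : f ∈ sys.Lam) : greenJ (x * e * y : R) (a * f * b) ↔ e = f := by
  have hei := sys.isIdempotentElem_of_mem e he
  have hfi := sys.isIdempotentElem_of_mem f hf
  rw [greenJ_iff]
  constructor
  · rintro ⟨⟨c, c', hc⟩, d, d', hd⟩
    obtain ⟨v, hv⟩ := sys.factorizable.exists_mul_conj_eq (e := e)
      (c := ((x⁻¹ : Rˣ) : R) * c * a) (d := b * c' * (y⁻¹ : Rˣ)) hfi (by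
        calc e = ((x⁻¹ : Rˣ) : R) * (x * e * y) * (y⁻¹ : Rˣ) := by simp [mul_assoc]
          _ = _ := by rw [hc]; simp [mul_assoc])
    obtain ⟨u, hu⟩ := sys.factorizable.exists_mul_conj_eq (e := f)
      (c := ((a⁻¹ : Rˣ) : R) * d * x) (d := y * d' * (b⁻¹ : Rˣ)) hei (by
        calc f = ((a⁻¹ : Rˣ) : R) * (a * f * b) * (b⁻¹ : Rˣ) := by simp [mul_assoc]
          _ = _ := by rw [hd]; simp [mul_assoc])
    -- The conjugators `u` and `v` are unrelated here, so one gets `e ≤ v⁻¹ f v ≤ (u v)⁻¹ e (u v)`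
    -- and needs finite order to close the loop.
    have h1 : (((v⁻¹ : Rˣ) : R) * f * v) * ((((u * v)⁻¹ : Rˣ) : R) * e * (u * v : Rˣ)) =
        ((v⁻¹ : Rˣ) : R) * f * v := by
      nth_rw 2 [← hu]
      simp [mul_assoc]
    have h2 : ((((u * v)⁻¹ : Rˣ) : R) * e * (u * v : Rˣ)) = e := by
      refine sys.factorizable.conj_eq_of_mul_eq hei ?_
      nth_rw 1 [← hv]
      rw [mul_assoc, h1, hv]
    rw [h2, sys.factorizable.idem_comm _ _ (isIdempotentElem_conj hfi v) hei, hv] at h1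
    exact (eq_of_conj he hf h1).1
  · rintro rfl
    exact ⟨⟨(x * a⁻¹ : Rˣ), (b⁻¹ * y : Rˣ), by simp [mul_assoc]⟩,
      ⟨(a * x⁻¹ : Rˣ), (y⁻¹ * b : Rˣ), by simp [mul_assoc]⟩⟩

/-! ### Standard forms as a bijection, and transfer of the results to the monoid. -/

namespace StdTriple

/-- The element with the given left (`ε = +`) or right (`ε = -`) standard form. -/
def val : AdherenceSign → sys.StdTriple → R
  | .plus, t => t.x * t.e * t.y
  | .minus, t => (t.y⁻¹ : Rˣ) * t.e * (t.x⁻¹ : Rˣ)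

/-- The `𝓛`- and `𝓡`-classes of the element determine `e`, `y` and `x W(e)`; cancelling `y` then
determines `x` modulo `W_*(e)`. -/
theorem val_injective (ε : AdherenceSign) : Function.Injective (val (sys := sys) ε) := by
  rintro ⟨x, e, y, he, hx, hy⟩ ⟨a, f, b, hf, ha, hb⟩ h
  have hL := congrArg (fun r : R => {t : R | ∃ a, t = a * r}) h
  have hR := congrArg (fun r : R => {t : R | ∃ b, t = r * b}) h
  have hy' : e = f ∧ y * b⁻¹ ∈ sys.cent e := by
    cases ε
    · exact (greenL_standard_iff he hf).1 hL
    · simpa using (greenR_standard_iff he hf).1 hR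
  have hx' : e = f ∧ x⁻¹ * a ∈ sys.cent e := by
    cases ε
    · exact (greenR_standard_iff he hf).1 hR
    · simpa using (greenL_standard_iff he hf).1 hL
  obtain ⟨rfl, hy'⟩ := hy'
  obtain rfl : b = y := eq_of_mem_minReps_left hb hy hy' (by group)
  obtain rfl : x = a := by
    refine eq_of_mem_minReps_right hx ha (z := x⁻¹ * a) ?_ (by group)
    have hc := (mem_cent he).1 hx'.2
    refine (mem_fixer he).2 ⟨hc, ?_⟩
    cases ε
    · have h : (x : R) * e * b = a * e * b := h
      rw [Units.mul_left_inj] at h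
      rw [Units.val_mul, mul_assoc, ← h, Units.inv_mul_cancel_left]
    · have h : ((b⁻¹ : Rˣ) : R) * e * (x⁻¹ : Rˣ) = (b⁻¹ : Rˣ) * e * (a⁻¹ : Rˣ) := h
      rw [mul_assoc, mul_assoc, Units.mul_right_inj] at h
      rw [hc, Units.val_mul, ← mul_assoc, h, mul_assoc, Units.inv_mul, mul_one]
  rfl

theorem val_surjective (ε : AdherenceSign) : Function.Surjective (val (sys := sys) ε) := by
  intro r
  cases ε
  · obtain ⟨g, hg, u, rfl⟩ := sys.factorizable.idem_mul_unit r
    obtain ⟨e, ⟨he, w, hw⟩, -⟩ := sys.transversal g hg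
    obtain ⟨z, hz, h1⟩ := exists_minRepL_eq (cs := sys.cs) (typeMap sys.cs e) (w * u)
    obtain ⟨q, hq, h2⟩ := exists_minRep_eq (cs := sys.cs) (lowerType sys.cs e) (w⁻¹ * z)
    refine ⟨⟨minRep sys.cs (lowerType sys.cs e) (w⁻¹ * z), e,
      minRepL sys.cs (typeMap sys.cs e) (w * u), he, minRep_mem _ _, minRepL_mem _ _⟩, ?_⟩
    have hz := (mem_cent he).1 hz
    have hq := ((mem_fixer he).1 hq).2
    simp only [val, h1, h2, Units.val_mul, mul_assoc]
    rw [← mul_assoc (q : R), hq, ← mul_assoc (z : R), hz, mul_assoc, Units.mul_inv_cancel_left,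
      ← hw]
    simp [mul_assoc]
  · obtain ⟨g, hg, u, rfl⟩ := sys.factorizable.unit_mul_idem r
    obtain ⟨e, ⟨he, w, hw⟩, -⟩ := sys.transversal g hg
    obtain ⟨z, hz, h1⟩ := exists_minRepL_eq (cs := sys.cs) (typeMap sys.cs e) (w * u⁻¹)
    obtain ⟨q, hq, h2⟩ := exists_minRep_eq (cs := sys.cs) (lowerType sys.cs e) (w⁻¹ * z)
    refine ⟨⟨minRep sys.cs (lowerType sys.cs e) (w⁻¹ * z), e,
      minRepL sys.cs (typeMap sys.cs e) (w * u⁻¹), he, minRep_mem _ _, minRepL_mem _ _⟩, ?_⟩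
    have hz := (mem_cent he).1 hz
    have hq := (mem_fixer he).1 (inv_mem hq)
    have hq : e * (q⁻¹ : Rˣ) = e := hq.1.symm.trans hq.2
    simp only [val, h1, h2, Units.val_mul, mul_assoc, mul_inv_rev, inv_inv]
    rw [← mul_assoc e, hq, ← mul_assoc (z : R), hz, mul_assoc, Units.mul_inv_cancel_left,
      ← hw]
    simp [mul_assoc]

theorem isLeftStandard_iff {r e : R} {x y : Rˣ} :
    sys.IsLeftStandard r x e y ↔
      ∃ t : sys.StdTriple, val .plus t = r ∧ t.x = x ∧ t.e = e ∧ t.y = y := by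
  constructor
  · rintro ⟨rfl, he, hx, hy⟩
    exact ⟨⟨x, e, y, he, hx, hy⟩, rfl, rfl, rfl, rfl⟩
  · rintro ⟨⟨x, e, y, he, hx, hy⟩, rfl, rfl, rfl, rfl⟩
    exact ⟨rfl, he, hx, hy⟩

theorem isRightStandard_iff {r e : R} {x y : Rˣ} :
    sys.IsRightStandard r y e x ↔
      ∃ t : sys.StdTriple, val .minus t = r ∧ t.x = x⁻¹ ∧ t.e = e ∧ t.y = y⁻¹ := by
  constructor
  · rintro ⟨rfl, he, hx, hy⟩
    refine ⟨⟨x⁻¹, e, y⁻¹, he, mem_minReps_left_iff_inv.1 hx,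
      mem_minReps_left_iff_inv.2 (by simpa using hy)⟩, ?_, rfl, rfl, rfl⟩
    simp [val]
  · rintro ⟨⟨x', e, y', he, hx, hy⟩, rfl, h, rfl, h'⟩
    obtain rfl : x' = x⁻¹ := h
    obtain rfl : y' = y⁻¹ := h'
    exact ⟨by simp [val], he, mem_minReps_left_iff_inv.2 hx,
      by simpa using mem_minReps_left_iff_inv.1 hy⟩

/-- `W(f) = W_{λ^*(f)} W_*(f)` and `W_*(f) ⊆ W_*(e)`, so allowing all of `W(f)` on the left gives
the same transition elements. -/
theorem le_iff_upper {t t' : sys.StdTriple} :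
    LE t t' ↔ IdemLE t.e t'.e ∧ ∃ p ∈ parabolic sys.cs (upperType sys.cs t'.e),
      ∃ q ∈ sys.fixer t.e, BruhatLE sys.cs t.x (t'.x * (p * q)) ∧
        BruhatLE sys.cs ((p * q)⁻¹ * t'.y) t.y := by
  constructor
  · rintro ⟨he, _, hp, q, hq, h⟩
    obtain ⟨p, hp', q', hq', rfl⟩ := exists_upper_mul_fixer t'.mem_lam hp
    exact ⟨he, p, hp', q' * q, MulMemClass.mul_mem (fixer_anti he hq') hq, by rwa [← mul_assoc p]⟩
  · rintro ⟨he, p, hp, q, hq, h⟩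
    exact ⟨he, p, upper_le_cent _ hp, q, hq, h⟩

theorem adhLE_val_iff (ε : AdherenceSign) {t t' : sys.StdTriple} :
    sys.AdhLE ε (val ε t) (val ε t') ↔ LE t t' := by
  rw [le_iff_upper]
  cases ε
  · constructor
    · rintro ⟨x, e, y, a, f, b, h1, h2, h⟩
      obtain ⟨t₁, k1, rfl, rfl, rfl⟩ := isLeftStandard_iff.1 h1
      obtain ⟨t₂, k2, rfl, rfl, rfl⟩ := isLeftStandard_iff.1 h2
      obtain rfl := val_injective _ k1
      obtain rfl := val_injective _ k2
      exact h
    · exact fun h => ⟨t.x, t.e, t.y, t'.x, t'.e, t'.y, isLeftStandard_iff.2 ⟨t, rfl, rfl, rfl, rfl⟩,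
        isLeftStandard_iff.2 ⟨t', rfl, rfl, rfl, rfl⟩, h⟩
  · constructor
    · rintro ⟨y, e, x, b, f, a, h1, h2, he, p, hp, q, hq, h3, h4⟩
      obtain ⟨t₁, k1, hx, rfl, hy⟩ := isRightStandard_iff.1 h1
      obtain ⟨t₂, k2, ha, rfl, hb⟩ := isRightStandard_iff.1 h2
      obtain rfl := val_injective _ k1
      obtain rfl := val_injective _ k2
      refine ⟨he, q⁻¹, inv_mem hq, p⁻¹, inv_mem hp, ?_, ?_⟩
      · rw [hx, ha]
        simpa using h3.inv
      · rw [hy, hb]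
        simpa using h4.inv
    · rintro ⟨he, p, hp, q, hq, h3, h4⟩
      refine ⟨t.y⁻¹, t.e, t.x⁻¹, t'.y⁻¹, t'.e, t'.x⁻¹,
        isRightStandard_iff.2 ⟨t, rfl, (inv_inv _).symm, rfl, (inv_inv _).symm⟩,
        isRightStandard_iff.2 ⟨t', rfl, (inv_inv _).symm, rfl, (inv_inv _).symm⟩, he,
        q⁻¹, inv_mem hq, p⁻¹, inv_mem hp, ?_, ?_⟩
      · simpa using h3.inv
      · simpa using h4.inv

end StdTriple

theorem adhLE_antisymm (ε : AdherenceSign) {r s : R} (h : sys.AdhLE ε r s)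
    (h' : sys.AdhLE ε s r) : r = s := by
  obtain ⟨t, rfl⟩ := StdTriple.val_surjective (sys := sys) ε r
  obtain ⟨t', rfl⟩ := StdTriple.val_surjective (sys := sys) ε s
  rw [StdTriple.adhLE_val_iff] at h h'
  rw [h.antisymm h']

theorem IsAbsMin.unique {ε : AdherenceSign} {T : R → R → Prop} {r m m' : R}
    (h : sys.IsAbsMin ε T r m) (h' : sys.IsAbsMin ε T r m') : m = m' :=
  sys.adhLE_antisymm ε (h.2 _ h'.1) (h'.2 _ h.1)

theorem IsAbsMax.unique {ε : AdherenceSign} {T : R → R → Prop} {r m m' : R}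
    (h : sys.IsAbsMax ε T r m) (h' : sys.IsAbsMax ε T r m') : m = m' :=
  sys.adhLE_antisymm ε (h'.2 _ h.1) (h.2 _ h'.1)

namespace StdTriple

theorem greenJ_val_iff [Finite Rˣ] (ε : AdherenceSign) (t t' : sys.StdTriple) :
    greenJ (val ε t) (val ε t') ↔ RelJ t t' := by
  cases ε <;> exact greenJ_standard_iff t.mem_lam t'.mem_lam

theorem relY_iff (t t' : sys.StdTriple) :
    RelY t t' ↔ t.e = t'.e ∧ t.y * t'.y⁻¹ ∈ sys.cent t.e := by
  refine and_congr_right fun he => ⟨fun h => by simp [h], fun h => ?_⟩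
  exact (eq_of_mem_minReps_left (he ▸ t'.y_mem) t.y_mem h (by group)).symm

theorem greenL_val_plus_iff (t t' : sys.StdTriple) :
    greenL (val .plus t) (val .plus t') ↔ RelY t t' := by
  rw [relY_iff]
  exact greenL_standard_iff t.mem_lam t'.mem_lam

theorem greenR_val_plus_iff (t t' : sys.StdTriple) :
    greenR (val .plus t) (val .plus t') ↔ RelX t t' :=
  greenR_standard_iff t.mem_lam t'.mem_lam

theorem greenL_val_minus_iff (t t' : sys.StdTriple) :
    greenL (val .minus t) (val .minus t') ↔ RelX t t' := by
  simpa [RelX, val] using greenL_standard_iff (sys := sys) (x := t.y⁻¹) (y := t.x⁻¹) (a := t'.y⁻¹)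
    (b := t'.x⁻¹) t.mem_lam t'.mem_lam

theorem greenR_val_minus_iff (t t' : sys.StdTriple) :
    greenR (val .minus t) (val .minus t') ↔ RelY t t' := by
  rw [relY_iff]
  simpa [val] using greenR_standard_iff (sys := sys) (x := t.y⁻¹) (y := t.x⁻¹) (a := t'.y⁻¹)
    (b := t'.x⁻¹) t.mem_lam t'.mem_lam

theorem greenH_val_iff (ε : AdherenceSign) (t t' : sys.StdTriple) :
    greenH (val ε t) (val ε t') ↔ RelH t t' := by
  cases ε
  · exact and_congr (greenL_val_plus_iff t t') (greenR_val_plus_iff t t')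
  · exact and_comm.trans (and_congr (greenR_val_minus_iff t t') (greenL_val_minus_iff t t'))

variable {ε : AdherenceSign} {T : R → R → Prop} {rel : sys.StdTriple → sys.StdTriple → Prop}
  {mn mx : sys.StdTriple → sys.StdTriple}

theorem HasExtrema.isAbsMin (h : HasExtrema rel mn mx)
    (hT : ∀ t t', T (val ε t) (val ε t') ↔ rel t t') (t : sys.StdTriple) :
    sys.IsAbsMin ε T (val ε t) (val ε (mn t)) := by
  refine ⟨(hT _ _).2 (h.rel_mn t), fun s hs => ?_⟩
  obtain ⟨t', rfl⟩ := val_surjective (sys := sys) ε s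
  exact (adhLE_val_iff ε).2 (h.mn_le _ _ ((hT _ _).1 hs))

theorem HasExtrema.isAbsMax (h : HasExtrema rel mn mx)
    (hT : ∀ t t', T (val ε t) (val ε t') ↔ rel t t') (t : sys.StdTriple) :
    sys.IsAbsMax ε T (val ε t) (val ε (mx t)) := by
  refine ⟨(hT _ _).2 (h.rel_mx t), fun s hs => ?_⟩
  obtain ⟨t', rfl⟩ := val_surjective (sys := sys) ε s
  exact (adhLE_val_iff ε).2 (h.le_mx _ _ ((hT _ _).1 hs))

theorem HasExtrema.existsUnique (h : HasExtrema rel mn mx)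
    (hT : ∀ t t', T (val ε t) (val ε t') ↔ rel t t') (r : R) :
    (∃! m, sys.IsAbsMin ε T r m) ∧ ∃! m, sys.IsAbsMax ε T r m := by
  obtain ⟨t, rfl⟩ := val_surjective (sys := sys) ε r
  exact ⟨⟨_, h.isAbsMin hT t, fun _ hm => hm.unique (h.isAbsMin hT t)⟩,
    ⟨_, h.isAbsMax hT t, fun _ hm => hm.unique (h.isAbsMax hT t)⟩⟩

theorem HasExtrema.absMaxLE_iff_someLE (h : HasExtrema rel mn mx)
    (hT : ∀ t t', T (val ε t) (val ε t') ↔ rel t t') (hE : Equivalence T) (r s : R) :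
    sys.AbsMaxLE ε T r s ↔ sys.SomeLE ε T r s := by
  constructor
  · rintro ⟨m, m', hm, hm', hle⟩
    exact ⟨m, m', hm.1, hm'.1, hle⟩
  · rintro ⟨a, b, ha, hb, hle⟩
    obtain ⟨t, rfl⟩ := val_surjective (sys := sys) ε a
    obtain ⟨t', rfl⟩ := val_surjective (sys := sys) ε b
    have h1 := h.isAbsMax hT t
    have h2 := h.isAbsMax hT t'
    exact ⟨_, _, ⟨hE.trans ha h1.1, fun u hu => h1.2 u (hE.trans (hE.symm ha) hu)⟩,
      ⟨hE.trans hb h2.1, fun u hu => h2.2 u (hE.trans (hE.symm hb) hu)⟩,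
      (adhLE_val_iff ε).2 (h.mx_mono _ _ ((adhLE_val_iff ε).1 hle))⟩

theorem HasExtrema.tfae (h : HasExtrema rel mn mx)
    (hT : ∀ t t', T (val ε t) (val ε t') ↔ rel t t') (hE : Equivalence T)
    (hmono : ∀ t t', LE t t' → LE (mn t) (mn t')) (r s : R) :
    List.TFAE [sys.AbsMinLE ε T r s, sys.AbsMaxLE ε T r s, sys.SomeLE ε T r s] := by
  have h1 := h.absMaxLE_iff_someLE hT hE r s
  tfae_have 2 ↔ 3 := h1
  tfae_have 1 → 3 := by
    rintro ⟨m, m', hm, hm', hle⟩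
    exact ⟨m, m', hm.1, hm'.1, hle⟩
  tfae_have 3 → 1 := by
    rintro ⟨a, b, ha, hb, hle⟩
    obtain ⟨t, rfl⟩ := val_surjective (sys := sys) ε a
    obtain ⟨t', rfl⟩ := val_surjective (sys := sys) ε b
    have h1 := h.isAbsMin hT t
    have h2 := h.isAbsMin hT t'
    exact ⟨_, _, ⟨hE.trans ha h1.1, fun u hu => h1.2 u (hE.trans (hE.symm ha) hu)⟩,
      ⟨hE.trans hb h2.1, fun u hu => h2.2 u (hE.trans (hE.symm hb) hu)⟩,
      (adhLE_val_iff ε).2 (hmono _ _ ((adhLE_val_iff ε).1 hle))⟩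
  tfae_finish

end StdTriple

section Extremal

variable [Finite Rˣ] (sys)

open StdTriple

theorem greenJ_extrema (ε : AdherenceSign) (r s : R) :
    ((∃! m, sys.IsAbsMin ε greenJ r m) ∧ ∃! m, sys.IsAbsMax ε greenJ r m) ∧
    List.TFAE [sys.AbsMinLE ε greenJ r s, sys.AbsMaxLE ε greenJ r s, sys.SomeLE ε greenJ r s] :=
  ⟨hasExtrema_relJ.existsUnique (greenJ_val_iff ε) r,
    hasExtrema_relJ.tfae (greenJ_val_iff ε) equivalence_greenJ (fun _ _ => minJ_mono) r s⟩

theorem greenL_extrema (ε : AdherenceSign) (r s : R) :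
    ((∃! m, sys.IsAbsMin ε greenL r m) ∧ ∃! m, sys.IsAbsMax ε greenL r m) ∧
    List.TFAE [sys.AbsMinLE ε greenL r s, sys.AbsMaxLE ε greenL r s, sys.SomeLE ε greenL r s] := by
  cases ε
  · exact ⟨hasExtrema_relY.existsUnique greenL_val_plus_iff r,
      hasExtrema_relY.tfae greenL_val_plus_iff equivalence_greenL (fun _ _ => minY_mono) r s⟩
  · exact ⟨hasExtrema_relX.existsUnique greenL_val_minus_iff r,
      hasExtrema_relX.tfae greenL_val_minus_iff equivalence_greenL (fun _ _ => minX_mono) r s⟩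

theorem greenR_extrema (ε : AdherenceSign) (r s : R) :
    ((∃! m, sys.IsAbsMin ε greenR r m) ∧ ∃! m, sys.IsAbsMax ε greenR r m) ∧
    List.TFAE [sys.AbsMinLE ε greenR r s, sys.AbsMaxLE ε greenR r s, sys.SomeLE ε greenR r s] := by
  cases ε
  · exact ⟨hasExtrema_relX.existsUnique greenR_val_plus_iff r,
      hasExtrema_relX.tfae greenR_val_plus_iff equivalence_greenR (fun _ _ => minX_mono) r s⟩
  · exact ⟨hasExtrema_relY.existsUnique greenR_val_minus_iff r,
      hasExtrema_relY.tfae greenR_val_minus_iff equivalence_greenR (fun _ _ => minY_mono) r s⟩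

theorem greenH_extrema (ε : AdherenceSign) (r s : R) :
    ((∃! m, sys.IsAbsMin ε greenH r m) ∧ ∃! m, sys.IsAbsMax ε greenH r m) ∧
    (sys.AbsMaxLE ε greenH r s ↔ sys.SomeLE ε greenH r s) :=
  ⟨hasExtrema_relH.existsUnique (greenH_val_iff ε) r,
    hasExtrema_relH.absMaxLE_iff_someLE (greenH_val_iff ε) equivalence_greenH r s⟩

end Extremal

end RennerCoxeterSystem

end RennerCoxeter

/-! ### Rook monoids as masked permutations. -/

namespace RennerCoxeter

section Rook

variable {n : ℕ}

/-- The rook matrix `∑ E_{σ(j), j}`, where `j` runs over the columns with `d j = true`. -/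
def rookEl (σ : Equiv.Perm (Fin n)) (d : Fin n → Bool) : rookMonoid n :=
  ⟨fun i j => if i = σ j ∧ d j = true then 1 else 0, by
    constructor
    · intro i
      calc ∑ j, (if i = σ j ∧ d j = true then 1 else 0)
          ≤ ∑ j, (if σ⁻¹ i = j then 1 else 0) := Finset.sum_le_sum fun j _ => by
            by_cases h : i = σ j
            · rw [h, if_pos (show σ⁻¹ (σ j) = j from Equiv.symm_apply_apply σ j)]
              split_ifs <;> simp
            · simp [h]
        _ ≤ 1 := by simp
    · intro j
      calc ∑ i, (if i = σ j ∧ d j = true then 1 else 0)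
          ≤ ∑ i, (if i = σ j then 1 else 0) := Finset.sum_le_sum fun i _ => by
            by_cases h : i = σ j
            · simp only [h, if_true]
              split_ifs <;> simp
            · simp [h]
        _ ≤ 1 := by simp⟩

theorem rookEl_apply (σ : Equiv.Perm (Fin n)) (d : Fin n → Bool) (i j : Fin n) :
    (rookEl σ d : Matrix (Fin n) (Fin n) ℕ) i j = if i = σ j ∧ d j = true then 1 else 0 := rfl

theorem rookEl_mul (σ τ : Equiv.Perm (Fin n)) (d d' : Fin n → Bool) :
    rookEl σ d * rookEl τ d' = rookEl (σ * τ) fun j => d' j && d (τ j) := by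
  apply Subtype.ext
  ext i j
  rw [Submonoid.coe_mul, Matrix.mul_apply]
  simp only [rookEl_apply]
  rw [Finset.sum_eq_single (τ j)]
  · by_cases h : d' j = true <;> simp [h]
  · intro k _ hk
    simp [hk]
  · simp

theorem rookEl_one : rookEl (1 : Equiv.Perm (Fin n)) (fun _ => true) = 1 := by
  apply Subtype.ext
  ext i j
  simp [rookEl_apply, Matrix.one_apply]

theorem rookEl_eq_iff {σ τ : Equiv.Perm (Fin n)} {d d' : Fin n → Bool} :
    rookEl σ d = rookEl τ d' ↔ ∀ j, d j = d' j ∧ (d j = true → σ j = τ j) := by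
  constructor
  · intro h j
    have h1 : ∀ i, _ := fun i => congrFun (congrFun (congrArg Subtype.val h) i) j
    simp only [rookEl_apply] at h1
    have h2 := h1 (σ j)
    have h3 := h1 (τ j)
    cases hd : d j <;> cases hd' : d' j <;> simp_all
  · intro h
    apply Subtype.ext
    ext i j
    obtain ⟨h1, h2⟩ := h j
    simp only [rookEl_apply, ← h1]
    by_cases hd : d j = true
    · simp [hd, h2 hd]
    · simp [hd]

theorem eq_zero_or_one_of_sum_le {f : Fin n → ℕ} (h : ∑ i, f i ≤ 1) (i : Fin n) :
    f i = 0 ∨ f i = 1 := by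
  have := Finset.single_le_sum (f := f) (fun _ _ => Nat.zero_le _) (Finset.mem_univ i)
  omega

theorem eq_of_sum_le {f : Fin n → ℕ} (h : ∑ i, f i ≤ 1) {i j : Fin n} (hi : f i ≠ 0)
    (hj : f j ≠ 0) : i = j := by
  by_contra hne
  have := Finset.sum_le_sum_of_subset (f := f) (Finset.subset_univ {i, j})
  rw [Finset.sum_pair hne] at this
  omega

theorem exists_rookEl (r : rookMonoid n) : ∃ σ d, r = rookEl σ d := by
  classical
  obtain ⟨A, hrow, hcol⟩ := r
  let f : Fin n → Fin n := fun j => if h : ∃ i, A i j ≠ 0 then h.choose else j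
  let s : Finset (Fin n) := Finset.univ.filter fun j => ∃ i, A i j ≠ 0
  have hf : ∀ j ∈ s, A (f j) j ≠ 0 := by
    intro j hj
    have hj : ∃ i, A i j ≠ 0 := by simpa [s] using hj
    simp only [f, dif_pos hj]
    exact hj.choose_spec
  have hinj : Set.InjOn f s := fun j hj k hk hjk =>
    eq_of_sum_le (hrow (f j)) (hf j hj) (hjk ▸ hf k hk)
  -- A rook matrix is a partial injection from its nonzero columns to rows; extend it to a
  -- permutation.
  obtain ⟨g, hg⟩ := Finset.exists_equiv_extend_of_card_eq (t := (Finset.univ : Finset (Fin n)))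
    (by simp) (Finset.subset_univ (s.image f)) hinj
  refine ⟨g.trans (Equiv.subtypeUnivEquiv Finset.mem_univ), fun j => decide (j ∈ s), ?_⟩
  apply Subtype.ext
  ext i j
  simp only [rookEl_apply, Equiv.trans_apply, Equiv.subtypeUnivEquiv_apply, decide_eq_true_eq]
  by_cases hj : j ∈ s
  · rw [hg j hj]
    have h1 := hf j hj
    split_ifs with h
    · rw [h.1]
      exact (eq_zero_or_one_of_sum_le (hcol j) (f j)).resolve_left h1
    · by_contra h2
      exact h ⟨eq_of_sum_le (hcol j) h2 h1, hj⟩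
  · have : ¬ ∃ i, A i j ≠ 0 := by simpa [s] using hj
    push Not at this
    simp [hj, this i]

instance : Finite (rookMonoid n) :=
  Finite.of_surjective (fun p : Equiv.Perm (Fin n) × (Fin n → Bool) => rookEl p.1 p.2) fun r => by
    obtain ⟨σ, d, rfl⟩ := exists_rookEl r
    exact ⟨(σ, d), rfl⟩

theorem isIdempotentElem_rookEl_iff {σ : Equiv.Perm (Fin n)} {d : Fin n → Bool} :
    IsIdempotentElem (rookEl σ d) ↔ rookEl σ d = rookEl 1 d := by
  rw [IsIdempotentElem, rookEl_mul, rookEl_eq_iff, rookEl_eq_iff]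
  refine forall_congr' fun j => ?_
  cases h : d j
  · simp
  · simp only [Bool.true_and, Equiv.Perm.mul_apply, EmbeddingLike.apply_eq_iff_eq, true_and,
      forall_const, Equiv.Perm.coe_one, id_eq]
    constructor
    · rintro ⟨h1, h2⟩
      exact h2 h1
    · intro h1
      simp [h1, h]

/-- The idempotents of the rook monoid. -/
def rookDiag (d : Fin n → Bool) : rookMonoid n := rookEl 1 d

theorem exists_rookDiag {e : rookMonoid n} (he : IsIdempotentElem e) : ∃ d, e = rookDiag d := by
  obtain ⟨σ, d, rfl⟩ := exists_rookEl e
  exact ⟨d, isIdempotentElem_rookEl_iff.1 he⟩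

theorem rookDiag_mul (d d' : Fin n → Bool) :
    rookDiag d * rookDiag d' = rookDiag fun j => d j && d' j := by
  rw [rookDiag, rookDiag, rookEl_mul, rookDiag, mul_one]
  simp [Bool.and_comm]

theorem isIdempotentElem_rookDiag (d : Fin n → Bool) : IsIdempotentElem (rookDiag d) := by
  rw [IsIdempotentElem, rookDiag_mul]
  simp

theorem rookDiag_inj {d d' : Fin n → Bool} : rookDiag d = rookDiag d' ↔ d = d' := by
  rw [rookDiag, rookDiag, rookEl_eq_iff, funext_iff]
  simp

/-- Permutation matrices as units of the rook monoid. -/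
def permUnit : Equiv.Perm (Fin n) →* (rookMonoid n)ˣ where
  toFun σ := ⟨rookEl σ fun _ => true, rookEl σ⁻¹ fun _ => true,
    by rw [rookEl_mul, mul_inv_cancel]; exact rookEl_one,
    by rw [rookEl_mul, inv_mul_cancel]; exact rookEl_one⟩
  map_one' := Units.ext rookEl_one
  map_mul' σ τ := Units.ext (by simp [rookEl_mul])

theorem coe_permUnit (σ : Equiv.Perm (Fin n)) :
    (permUnit σ : rookMonoid n) = rookEl σ fun _ => true := rfl

theorem permUnit_bijective : Function.Bijective (permUnit (n := n)) := by
  constructor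
  · intro σ τ h
    have h := congrArg Units.val h
    rw [coe_permUnit, coe_permUnit, rookEl_eq_iff] at h
    exact Equiv.ext fun j => (h j).2 rfl
  · intro u
    obtain ⟨σ, d, h⟩ := exists_rookEl (u : rookMonoid n)
    obtain ⟨τ, d', h'⟩ := exists_rookEl ((u⁻¹ : (rookMonoid n)ˣ) : rookMonoid n)
    have h1 := Units.inv_mul u
    rw [h, h', rookEl_mul, ← rookEl_one, rookEl_eq_iff] at h1
    refine ⟨σ, Units.ext ?_⟩
    rw [coe_permUnit, h, rookEl_eq_iff]
    intro j
    have := (h1 j).1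
    simp only [Bool.and_eq_true] at this
    simp [this.1]

/-- The unit group of the rook monoid is the symmetric group. -/
noncomputable def permUnitEquiv : Equiv.Perm (Fin n) ≃* (rookMonoid n)ˣ :=
  MulEquiv.ofBijective permUnit permUnit_bijective

theorem permUnit_mul_rookDiag (σ : Equiv.Perm (Fin n)) (d : Fin n → Bool) :
    (permUnit σ : rookMonoid n) * rookDiag d = rookEl σ d := by
  rw [coe_permUnit, rookDiag, rookEl_mul, mul_one]
  simp

theorem rookDiag_mul_permUnit (σ : Equiv.Perm (Fin n)) (d : Fin n → Bool) :
    rookDiag d * (permUnit σ : rookMonoid n) = rookEl σ (d ∘ σ) := by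
  rw [coe_permUnit, rookDiag, rookEl_mul, one_mul]
  simp [Function.comp_def]

theorem permUnit_commute_iff {σ : Equiv.Perm (Fin n)} {d : Fin n → Bool} :
    (permUnit σ : rookMonoid n) * rookDiag d = rookDiag d * (permUnit σ : rookMonoid n) ↔
      ∀ j, d j = d (σ j) := by
  rw [permUnit_mul_rookDiag, rookDiag_mul_permUnit, rookEl_eq_iff]
  simp

theorem permUnit_fix_iff {σ : Equiv.Perm (Fin n)} {d : Fin n → Bool} :
    (permUnit σ : rookMonoid n) * rookDiag d = rookDiag d ↔ ∀ j, d j = true → σ j = j := by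
  rw [permUnit_mul_rookDiag, rookDiag, rookEl_eq_iff]
  simp

theorem permUnit_conj (σ : Equiv.Perm (Fin n)) (d : Fin n → Bool) :
    (permUnit σ : rookMonoid n) * rookDiag d * ((permUnit σ)⁻¹ : (rookMonoid n)ˣ) =
      rookDiag (d ∘ ⇑σ⁻¹) := by
  rw [← map_inv, permUnit_mul_rookDiag, coe_permUnit, rookEl_mul, mul_inv_cancel]
  simp [rookDiag, Function.comp_def]

theorem isFactorizable_rookMonoid : IsFactorizable (rookMonoid n) where
  idem_mul_unit r := by
    obtain ⟨σ, d, rfl⟩ := exists_rookEl r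
    refine ⟨rookDiag (d ∘ ⇑σ⁻¹), isIdempotentElem_rookDiag _, permUnit σ, ?_⟩
    rw [rookDiag_mul_permUnit]
    simp [Function.comp_def]
  unit_mul_idem r := by
    obtain ⟨σ, d, rfl⟩ := exists_rookEl r
    exact ⟨rookDiag d, isIdempotentElem_rookDiag _, permUnit σ, (permUnit_mul_rookDiag σ d).symm⟩
  idem_comm e f he hf := by
    obtain ⟨d, rfl⟩ := exists_rookDiag he
    obtain ⟨d', rfl⟩ := exists_rookDiag hf
    simp [rookDiag_mul, Bool.and_comm]

theorem idemLE_rookDiag_iff {d d' : Fin n → Bool} :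
    IdemLE (rookDiag d) (rookDiag d') ↔ ∀ j, (d j && d' j) = d j := by
  rw [IdemLE, rookDiag_mul, rookDiag_mul, rookDiag_inj, rookDiag_inj, funext_iff, funext_iff]
  simp [Bool.and_comm]

end Rook

/-! ### Type `A₂` and the Renner–Coxeter system on the `3 × 3` rook monoid. -/

section SymmetricGroup

/-- The adjacent transpositions of `Fin 3`. -/
def adjSwap : Fin 2 → Equiv.Perm (Fin 3) := ![Equiv.swap 0 1, Equiv.swap 1 2]

theorem isLiftable_adjSwap : (CoxeterMatrix.A 2).IsLiftable adjSwap := by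
  intro i j
  fin_cases i <;> fin_cases j <;> decide

/-- The homomorphism from the Coxeter group of type `A₂` to the symmetric group. -/
def coxeterToPerm : (CoxeterMatrix.A 2).Group →* Equiv.Perm (Fin 3) :=
  (CoxeterMatrix.A 2).toCoxeterSystem.lift ⟨adjSwap, isLiftable_adjSwap⟩

theorem coxeterToPerm_simple (i : Fin 2) :
    coxeterToPerm ((CoxeterMatrix.A 2).simple i) = adjSwap i :=
  (CoxeterMatrix.A 2).toCoxeterSystem.lift_apply_simple isLiftable_adjSwap i

/-- Words for the elements of the symmetric group on three letters. -/
def permWords : List (List (Fin 2)) := [[], [0], [1], [0, 1], [1, 0], [0, 1, 0]]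

theorem exists_permWord (σ : Equiv.Perm (Fin 3)) :
    ∃ l ∈ permWords, (l.map adjSwap).prod = σ := by
  revert σ
  decide

theorem coxeterToPerm_wordProd (l : List (Fin 2)) :
    coxeterToPerm ((CoxeterMatrix.A 2).toCoxeterSystem.wordProd l) = (l.map adjSwap).prod := by
  simp [CoxeterSystem.wordProd, map_list_prod, coxeterToPerm_simple, Function.comp_def]

/-- The braid relation makes the six listed words closed under left multiplication by generators.
Injectivity of `coxeterToPerm` then reduces to inspecting six permutations. -/
theorem exists_wordProd_eq {W : Type*} [Group W] (cs : CoxeterSystem (CoxeterMatrix.A 2) W)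
    (w : W) : ∃ l ∈ permWords, cs.wordProd l = w := by
  have hb : cs.simple 1 * (cs.simple 0 * cs.simple 1) =
      cs.simple 0 * (cs.simple 1 * cs.simple 0) := by
    have h := cs.simple_mul_simple_pow 0 1
    rw [show (CoxeterMatrix.A 2) 0 1 = 3 by decide] at h
    have h : (cs.simple 0 * (cs.simple 1 * cs.simple 0)) *
        (cs.simple 1 * (cs.simple 0 * cs.simple 1)) = 1 := by
      rw [← h]
      simp [pow_succ, mul_assoc]
    rw [eq_inv_of_mul_eq_one_right h]
    simp [mul_assoc]
  have hb' : ∀ v, cs.simple 1 * (cs.simple 0 * (cs.simple 1 * v)) =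
      cs.simple 0 * (cs.simple 1 * (cs.simple 0 * v)) := by
    intro v
    simpa only [mul_assoc] using congrArg (· * v) hb
  induction w using cs.simple_induction_left with
  | one => exact ⟨[], by simp [permWords], by simp⟩
  | mul_simple_left w i ih =>
    obtain ⟨l, hl, rfl⟩ := ih
    simp only [permWords, List.mem_cons, List.not_mem_nil, or_false] at hl
    rcases hl with rfl | rfl | rfl | rfl | rfl | rfl <;> fin_cases i <;>
      simp [permWords, cs.wordProd_cons, hb, hb']

theorem coxeterToPerm_bijective : Function.Bijective coxeterToPerm := by
  constructor
  · rw [injective_iff_map_eq_one]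
    intro w hw
    obtain ⟨l, hl, rfl⟩ := exists_wordProd_eq (CoxeterMatrix.A 2).toCoxeterSystem w
    rw [coxeterToPerm_wordProd] at hw
    have : ∀ l ∈ permWords, (l.map adjSwap).prod = 1 → l = [] := by decide
    rw [this l hl hw, CoxeterSystem.wordProd_nil]
  · intro σ
    obtain ⟨l, -, rfl⟩ := exists_permWord σ
    exact ⟨_, coxeterToPerm_wordProd l⟩

/-- The Coxeter system on the unit group of the `3 × 3` rook monoid. -/
noncomputable def rookCoxeterSystem : CoxeterSystem (CoxeterMatrix.A 2) (rookMonoid 3)ˣ :=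
  (CoxeterMatrix.A 2).toCoxeterSystem.map
    ((MulEquiv.ofBijective coxeterToPerm coxeterToPerm_bijective).trans permUnitEquiv)

theorem rookCoxeterSystem_simple (i : Fin 2) :
    rookCoxeterSystem.simple i = permUnit (adjSwap i) := by
  rw [rookCoxeterSystem, CoxeterSystem.map_simple, CoxeterMatrix.toCoxeterSystem_simple,
    ← coxeterToPerm_simple]
  rfl

/-- A subgroup of the symmetric group whose elements have words in the generators it contains
corresponds to a standard parabolic subgroup. -/
theorem exists_parabolic (P : Equiv.Perm (Fin 3) → Prop) (one : P 1)
    (mul : ∀ σ τ, P σ → P τ → P (σ * τ))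
    (h : ∀ σ, P σ → ∃ l ∈ permWords, (∀ i ∈ l, P (adjSwap i)) ∧ (l.map adjSwap).prod = σ) :
    ∃ I : Set (Fin 2), ∀ σ, P σ ↔ permUnit σ ∈ parabolic rookCoxeterSystem I := by
  refine ⟨{i | P (adjSwap i)}, fun σ => ⟨fun hσ => ?_, fun hσ => ?_⟩⟩
  · obtain ⟨l, -, hl, rfl⟩ := h σ hσ
    rw [map_list_prod]
    refine Subgroup.list_prod_mem _ fun u hu => ?_
    simp only [List.map_map, List.mem_map, Function.comp_apply] at hu
    obtain ⟨i, hi, rfl⟩ := hu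
    rw [← rookCoxeterSystem_simple]
    exact simple_mem_parabolic (hl i hi)
  · have key : ∀ u ∈ parabolic rookCoxeterSystem {i | P (adjSwap i)},
        ∃ τ, permUnit τ = u ∧ P τ := by
      intro u hu
      refine parabolic_induction (p := fun u => ∃ τ, permUnit τ = u ∧ P τ)
        ⟨1, map_one _, one⟩ ?_ hu
      rintro _ i hi ⟨τ, rfl, hτ⟩
      exact ⟨τ * adjSwap i, by rw [map_mul, rookCoxeterSystem_simple], mul _ _ hτ hi⟩
    obtain ⟨τ, hτ, hP⟩ := key _ hσ
    rwa [← permUnit_bijective.1 hτ]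

/-- The diagonal of `diag(1ᵏ, 0³⁻ᵏ)`. -/
def initial (k : Fin 4) (j : Fin 3) : Bool := decide (j.val < k.val)

set_option synthInstance.maxSize 1024 in
theorem exists_fixer_word : ∀ k, ∀ σ : Equiv.Perm (Fin 3),
    ((∀ j, initial k j = initial k (σ j)) ∧ ∀ j, initial k j = true → σ j = j) →
    ∃ l ∈ permWords, (∀ i ∈ l, (∀ j, initial k j = initial k (adjSwap i j)) ∧
      ∀ j, initial k j = true → adjSwap i j = j) ∧ (l.map adjSwap).prod = σ := by
  decide

/-- The standard Renner-Coxeter system on the `3 × 3` rook monoid. -/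
noncomputable def rookSystem : RennerCoxeterSystem (rookMonoid 3) (CoxeterMatrix.A 2) where
  factorizable := isFactorizable_rookMonoid
  cs := rookCoxeterSystem
  Lam := Set.range fun k => rookDiag (initial k)
  isIdempotentElem_of_mem := by
    rintro _ ⟨k, rfl⟩
    exact isIdempotentElem_rookDiag _
  transversal := by
    intro e he
    obtain ⟨d, rfl⟩ := exists_rookDiag he
    have hex : ∀ d : Fin 3 → Bool, ∃ k, ∃ σ : Equiv.Perm (Fin 3), ∀ j,
        (d ∘ ⇑σ⁻¹) j = initial k j := by decide
    have huniq : ∀ k k', ∀ σ : Equiv.Perm (Fin 3), (∀ j, initial k' (σ j) = initial k j) →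
        k' = k := by decide
    obtain ⟨k, σ, hσ⟩ := hex d
    refine ⟨rookDiag (initial k), ⟨⟨k, rfl⟩, permUnit σ, ?_⟩, ?_⟩
    · rw [permUnit_conj, funext hσ]
    · rintro _ ⟨⟨k', rfl⟩, w, hw⟩
      obtain ⟨τ, rfl⟩ := permUnit_bijective.2 w
      simp only at hw ⊢
      rw [permUnit_conj, rookDiag_inj] at hw
      -- Both initial segments are permuted copies of `d`, so `τ σ⁻¹` carries one to the other and
      -- they have the same size.
      rw [huniq k k' (τ * σ⁻¹) fun j => ?_]
      rw [← hw, ← hσ]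
      simp
  mul_mem := by
    rintro _ ⟨k, rfl⟩ _ ⟨k', rfl⟩
    have : ∀ k k', ∃ l, ∀ j, initial l j = (initial k j && initial k' j) := by decide
    obtain ⟨l, hl⟩ := this k k'
    exact ⟨l, by simp only [rookDiag_mul, ← hl]⟩
  conj_pair := by
    intro e e' he he' h
    obtain ⟨d, rfl⟩ := exists_rookDiag he
    obtain ⟨d', rfl⟩ := exists_rookDiag he'
    have : ∀ d d' : Fin 3 → Bool, (∀ j, (d j && d' j) = d j) → ∃ k k',
        k.val ≤ k'.val ∧ ∃ σ : Equiv.Perm (Fin 3),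
        (∀ j, (d ∘ ⇑σ⁻¹) j = initial k j) ∧ ∀ j, (d' ∘ ⇑σ⁻¹) j = initial k' j := by
      decide
    obtain ⟨k, k', hk, σ, h1, h2⟩ := this d d' (idemLE_rookDiag_iff.1 h)
    refine ⟨permUnit σ, _, ⟨k, rfl⟩, _, ⟨k', rfl⟩, idemLE_rookDiag_iff.2 fun j => ?_, ?_, ?_⟩
    · simp only [initial]
      by_cases hj : j.val < k.val
      · simp [hj, hj.trans_le hk]
      · simp [hj]
    · rw [permUnit_conj, funext h1]
    · rw [permUnit_conj, funext h2]
  upperType_mono := by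
    rintro _ ⟨k, rfl⟩ _ ⟨k', rfl⟩ h i ⟨h1, h2⟩
    have : ∀ k k' i, (∀ j, (initial k j && initial k' j) = initial k j) →
        (∀ j, initial k j = initial k (adjSwap i j)) →
        (¬ ∀ j, initial k j = true → adjSwap i j = j) →
        (∀ j, initial k' j = initial k' (adjSwap i j)) ∧
        (¬ ∀ j, initial k' j = true → adjSwap i j = j) := by decide
    rw [rookCoxeterSystem_simple, permUnit_commute_iff] at h1
    rw [rookCoxeterSystem_simple, Ne, permUnit_fix_iff] at h2
    obtain ⟨h3, h4⟩ := this k k' i (idemLE_rookDiag_iff.1 h) h1 h2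
    constructor
    · rwa [rookCoxeterSystem_simple, permUnit_commute_iff]
    · rwa [rookCoxeterSystem_simple, Ne, permUnit_fix_iff]
  centralizer_parabolic := by
    rintro _ ⟨k, rfl⟩
    obtain ⟨I, hI⟩ := exists_parabolic (fun σ => ∀ j, initial k j = initial k (σ j))
      (fun _ => rfl) (fun σ τ hσ hτ j => (hτ j).trans (hσ _)) (by revert k; decide)
    refine ⟨I, fun w => ?_⟩
    obtain ⟨σ, rfl⟩ := permUnit_bijective.2 w
    rw [← hI, permUnit_commute_iff]
  fixer_parabolic := by
    rintro _ ⟨k, rfl⟩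
    obtain ⟨I, hI⟩ := exists_parabolic (fun σ => (∀ j, initial k j = initial k (σ j)) ∧
      ∀ j, initial k j = true → σ j = j) ⟨fun _ => rfl, fun _ _ => rfl⟩
      (fun σ τ hσ hτ => ⟨fun j => (hτ.1 j).trans (hσ.1 _), fun j hj => by
        rw [Equiv.Perm.mul_apply, hτ.2 j hj, hσ.2 j hj]⟩) (exists_fixer_word k)
    refine ⟨I, fun w => ?_⟩
    obtain ⟨σ, rfl⟩ := permUnit_bijective.2 w
    rw [← hI, permUnit_commute_iff, permUnit_fix_iff]

theorem isStandardRook_rookSystem : IsStandardRook rookSystem := by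
  refine ⟨?_, ?_, fun e => ?_⟩
  · change ((rookCoxeterSystem.simple 0 : rookMonoid 3) : Matrix (Fin 3) (Fin 3) ℕ) = _
    rw [rookCoxeterSystem_simple, coe_permUnit]
    decide
  · change ((rookCoxeterSystem.simple 1 : rookMonoid 3) : Matrix (Fin 3) (Fin 3) ℕ) = _
    rw [rookCoxeterSystem_simple, coe_permUnit]
    decide
  · have h3 : (rookDiag (initial 3) : Matrix (Fin 3) (Fin 3) ℕ) = 1 := by decide
    have h2 : (rookDiag (initial 2) : Matrix (Fin 3) (Fin 3) ℕ) =
      !![1, 0, 0; 0, 1, 0; 0, 0, 0] := by decide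
    have h1 : (rookDiag (initial 1) : Matrix (Fin 3) (Fin 3) ℕ) =
      !![1, 0, 0; 0, 0, 0; 0, 0, 0] := by decide
    have h0 : (rookDiag (initial 0) : Matrix (Fin 3) (Fin 3) ℕ) = 0 := by decide
    rw [← h3, ← h2, ← h1, ← h0]
    simp only [Set.mem_insert_iff, Set.mem_singleton_iff, Subtype.val_inj]
    constructor
    · rintro ⟨k, rfl⟩
      fin_cases k <;> simp
    · rintro (rfl | rfl | rfl | rfl)
      exacts [⟨3, rfl⟩, ⟨2, rfl⟩, ⟨1, rfl⟩, ⟨0, rfl⟩]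

end SymmetricGroup

end RennerCoxeter

/-! ### The counterexample for `𝓗`. -/

namespace RennerCoxeter

section Counterexample

open RennerCoxeterSystem StdTriple

theorem rookSystem_simple (i : Fin 2) : rookSystem.cs.simple i = permUnit (adjSwap i) :=
  rookCoxeterSystem_simple i

theorem initial_three : rookDiag (initial 3) = 1 :=
  (congrArg rookDiag (by decide)).trans rookEl_one

theorem lowerType_initial_eq_empty {k : Fin 4} (hk : 2 ≤ k) :
    lowerType rookSystem.cs (rookDiag (initial k)) = ∅ := by
  refine Set.eq_empty_of_forall_notMem fun i hi => ?_
  have h := hi.2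
  rw [rookSystem_simple, permUnit_fix_iff] at h
  clear hi
  revert k i
  decide

theorem mem_minReps_empty {B W : Type*} [Group W] {M : CoxeterMatrix B}
    (cs : CoxeterSystem M W) (u : W) : u ∈ minReps cs ∅ ∅ :=
  mem_minReps_right_of_forall_simple fun _ hi => hi.elim

/-- The triple `(σ, diag(1ᵏ, 0³⁻ᵏ), 1)` for `k ≥ 2`. -/
def rookTriple (σ : Equiv.Perm (Fin 3)) (k : Fin 4) (hk : 2 ≤ k) : rookSystem.StdTriple where
  x := permUnit σ
  e := rookDiag (initial k)
  y := 1
  mem_lam := ⟨k, rfl⟩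
  x_mem := by
    rw [lowerType_initial_eq_empty hk]
    exact mem_minReps_empty _ _
  y_mem := one_mem_minReps

theorem val_plus_rookTriple (σ : Equiv.Perm (Fin 3)) (k : Fin 4) (hk : 2 ≤ k) :
    val .plus (rookTriple σ k hk) = rookEl σ (initial k) := by
  simp [val, rookTriple, permUnit_mul_rookDiag]

theorem val_plus_eq_rookA : val .plus (rookTriple (Equiv.swap 0 2) 2 le_rfl) = rookA := by
  rw [val_plus_rookTriple]
  exact Subtype.ext (by decide)

theorem val_plus_eq_rookB :
    val .plus (rookTriple (adjSwap 0 * adjSwap 1) 2 le_rfl) = rookB := by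
  rw [val_plus_rookTriple]
  exact Subtype.ext (by decide)

theorem val_plus_eq_rookC : val .plus (rookTriple (Equiv.swap 0 2) 3 (by decide)) = rookC := by
  rw [val_plus_rookTriple]
  exact Subtype.ext (by decide)

theorem val_plus_eq_one : val .plus (rookTriple 1 3 (by decide)) = 1 := by
  rw [val_plus_rookTriple]
  exact initial_three

/-- Only `s₀` commutes with `diag(1, 1, 0)`. If `s₀s₁s₀` were shorter than `s₀s₁`, it would have
length at most `1`, but it is neither the identity nor a generator. -/
theorem permUnit_cycle_mem :
    permUnit (adjSwap 0 * adjSwap 1) ∈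
      minReps rookSystem.cs ∅ (typeMap rookSystem.cs (rookDiag (initial 2))) := by
  refine mem_minReps_right_of_forall_simple fun i hi => ?_
  replace hi : (rookSystem.cs.simple i : rookMonoid 3) * _ = _ := hi
  rw [rookSystem_simple, permUnit_commute_iff] at hi
  obtain rfl : i = 0 := by
    revert i
    decide
  refine (bruhatLE_mul_simple_total _ _).resolve_right fun h => ?_
  have h1 := h.length_le
  have h2 := rookSystem.cs.length_mul_simple (permUnit (adjSwap 0 * adjSwap 1)) 0
  have h3 := rookSystem.cs.length_mul_le (permUnit (adjSwap 0)) (permUnit (adjSwap 1))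
  rw [← rookSystem_simple, ← rookSystem_simple, CoxeterSystem.length_simple,
    CoxeterSystem.length_simple, rookSystem_simple, rookSystem_simple, ← map_mul] at h3
  have h4 : rookSystem.cs.length (permUnit (adjSwap 0 * adjSwap 1) * rookSystem.cs.simple 0) = 0 ∨
      rookSystem.cs.length (permUnit (adjSwap 0 * adjSwap 1) * rookSystem.cs.simple 0) = 1 := by
    omega
  rw [CoxeterSystem.length_eq_zero_iff, CoxeterSystem.length_eq_one_iff, rookSystem_simple,
    ← map_mul] at h4
  rcases h4 with h4 | ⟨i, h4⟩
  · rw [map_eq_one_iff _ permUnit_bijective.1] at h4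
    revert h4
    decide
  · rw [rookSystem_simple, permUnit_bijective.1.eq_iff] at h4
    revert i
    decide

/-- Recognition of the least element of a `RelH`-class. -/
theorem minH_eq {R : Type*} [Monoid R] {B : Type*} {M : CoxeterMatrix B}
    {sys : RennerCoxeterSystem R M} {t t' : sys.StdTriple} (h : RelH t t')
    (hx : t'.x ∈ minReps sys.cs ∅ (typeMap sys.cs t.e)) : minH t = t' := by
  obtain ⟨x, e, y, he, hx', hy⟩ := t
  obtain ⟨a, f, b, hf, ha, hb⟩ := t'
  obtain ⟨⟨rfl, rfl⟩, -, h⟩ := h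
  dsimp only at *
  obtain ⟨z, hz, h'⟩ := exists_minRep_eq (cs := sys.cs) (typeMap sys.cs e) x
  have : minRep sys.cs (typeMap sys.cs e) x = a :=
    eq_of_mem_minReps_right (minRep_mem _ _) hx
      (MulMemClass.mul_mem (inv_mem hz) h) (by rw [h']; group)
  subst this
  rfl

theorem minH_rookTriple_two :
    minH (rookTriple (Equiv.swap 0 2) 2 le_rfl) = rookTriple (adjSwap 0 * adjSwap 1) 2 le_rfl := by
  refine minH_eq ⟨⟨rfl, rfl⟩, rfl, (mem_cent (rookTriple (Equiv.swap 0 2) 2 le_rfl).mem_lam).2 ?_⟩ permUnit_cycle_mem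
  change ((permUnit _)⁻¹ * permUnit _ : (rookMonoid 3)ˣ).val * rookDiag (initial 2) =
    rookDiag (initial 2) * ((permUnit _)⁻¹ * permUnit _ : (rookMonoid 3)ˣ).val
  rw [← map_inv, ← map_mul, permUnit_commute_iff]
  decide

theorem minH_rookTriple_three :
    minH (rookTriple (Equiv.swap 0 2) 3 (by decide)) = rookTriple 1 3 (by decide) := by
  refine minH_eq ⟨⟨rfl, rfl⟩, rfl, (mem_cent (rookTriple (Equiv.swap 0 2) 3 (by decide)).mem_lam).2 ?_⟩ ?_
  · change _ * rookDiag (initial 3) = rookDiag (initial 3) * _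
    rw [initial_three, one_mul, mul_one]
  · change permUnit 1 ∈ _
    rw [map_one]
    exact one_mem_minReps

theorem rookTriple_le :
    LE (rookTriple (Equiv.swap 0 2) 2 le_rfl) (rookTriple (Equiv.swap 0 2) 3 (by decide)) :=
  le_of_bruhatLE (idemLE_rookDiag_iff.2 (by decide)) (.refl _) (.refl _)

/-- Both `y`-parts are `1`, so `w⁻¹ ≤ 1` forces the transition element to be trivial, leaving `s₀s₁
≤ 1`. -/
theorem rookTriple_not_le :
    ¬ LE (rookTriple (adjSwap 0 * adjSwap 1) 2 le_rfl) (rookTriple 1 3 (by decide)) := by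
  rintro ⟨-, p, -, q, -, h1, h2⟩
  change BruhatLE rookSystem.cs (permUnit (adjSwap 0 * adjSwap 1)) (permUnit 1 * (p * q)) at h1
  change BruhatLE rookSystem.cs ((p * q)⁻¹ * 1) 1 at h2
  have h3 := bruhatLE_one h2
  rw [mul_one, inv_eq_one] at h3
  rw [h3, map_one, mul_one] at h1
  have h4 := bruhatLE_one h1
  rw [map_eq_one_iff _ permUnit_bijective.1] at h4
  revert h4
  decide

theorem isAbsMin_rookA : rookSystem.IsAbsMin .plus greenH rookA rookB := by
  have h := hasExtrema_relH.isAbsMin (greenH_val_iff .plus)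
    (rookTriple (Equiv.swap 0 2) 2 le_rfl)
  rwa [minH_rookTriple_two, val_plus_eq_rookA, val_plus_eq_rookB] at h

theorem isAbsMin_rookC : rookSystem.IsAbsMin .plus greenH rookC 1 := by
  have h := hasExtrema_relH.isAbsMin (greenH_val_iff .plus)
    (rookTriple (Equiv.swap 0 2) 3 (by decide))
  rwa [minH_rookTriple_three, val_plus_eq_rookC, val_plus_eq_one] at h

/-- The same two triples serve for both signs, since `val ε` transports `LE` and `RelH` to `≤^ε` and
`𝓗` in either case. -/
theorem exists_not_absMinLE (ε : AdherenceSign) : ∃ r s : rookMonoid 3,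
    rookSystem.AbsMaxLE ε greenH r s ∧ rookSystem.SomeLE ε greenH r s ∧
      ¬ rookSystem.AbsMinLE ε greenH r s := by
  have hs : rookSystem.SomeLE ε greenH (val ε (rookTriple (Equiv.swap 0 2) 2 le_rfl))
      (val ε (rookTriple (Equiv.swap 0 2) 3 (by decide))) :=
    ⟨_, _, equivalence_greenH.refl _, equivalence_greenH.refl _,
      (adhLE_val_iff ε).2 rookTriple_le⟩
  refine ⟨_, _, (rookSystem.greenH_extrema ε _ _).2.2 hs, hs, ?_⟩
  rintro ⟨m, m', hm, hm', hle⟩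
  rw [hm.unique (hasExtrema_relH.isAbsMin (greenH_val_iff ε) _),
    hm'.unique (hasExtrema_relH.isAbsMin (greenH_val_iff ε) _), minH_rookTriple_two,
    minH_rookTriple_three, adhLE_val_iff] at hle
  exact rookTriple_not_le hle

end Counterexample

end RennerCoxeter

theorem mainTheorem4 :
    (∀ (R : Type*) [Monoid R] [Finite R] (B : Type*) (M : CoxeterMatrix B)
      (sys : RennerCoxeter.RennerCoxeterSystem R M) (ε : RennerCoxeter.AdherenceSign) (r s : R),
      (∀ T ∈ ({RennerCoxeter.greenJ, RennerCoxeter.greenL, RennerCoxeter.greenR,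
          RennerCoxeter.greenH} : Set (R → R → Prop)),
        (∃! m, sys.IsAbsMin ε T r m) ∧ (∃! m, sys.IsAbsMax ε T r m)) ∧
      (∀ T ∈ ({RennerCoxeter.greenJ, RennerCoxeter.greenL, RennerCoxeter.greenR} :
          Set (R → R → Prop)),
        List.TFAE [sys.AbsMinLE ε T r s, sys.AbsMaxLE ε T r s, sys.SomeLE ε T r s]) ∧
      (sys.AbsMaxLE ε RennerCoxeter.greenH r s ↔ sys.SomeLE ε RennerCoxeter.greenH r s)) ∧
    (∃ sys : RennerCoxeter.RennerCoxeterSystem (RennerCoxeter.rookMonoid 3) (CoxeterMatrix.A 2),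
      RennerCoxeter.IsStandardRook sys ∧
      sys.AdhLE .plus RennerCoxeter.rookA RennerCoxeter.rookC ∧
      sys.IsAbsMin .plus RennerCoxeter.greenH RennerCoxeter.rookA RennerCoxeter.rookB ∧
      sys.IsAbsMin .plus RennerCoxeter.greenH RennerCoxeter.rookC 1 ∧
      ¬ sys.AdhLE .plus RennerCoxeter.rookB 1 ∧
      ∀ ε : RennerCoxeter.AdherenceSign, ∃ r s : RennerCoxeter.rookMonoid 3,
        sys.AbsMaxLE ε RennerCoxeter.greenH r s ∧ sys.SomeLE ε RennerCoxeter.greenH r s ∧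
          ¬ sys.AbsMinLE ε RennerCoxeter.greenH r s) := by
  constructor
  · intro R _ _ B M sys ε r s
    refine ⟨?_, ?_, (sys.greenH_extrema ε r s).2⟩
    · rintro T (rfl | rfl | rfl | rfl)
      exacts [(sys.greenJ_extrema ε r s).1, (sys.greenL_extrema ε r s).1,
        (sys.greenR_extrema ε r s).1, (sys.greenH_extrema ε r s).1]
    · rintro T (rfl | rfl | rfl)
      exacts [(sys.greenJ_extrema ε r s).2, (sys.greenL_extrema ε r s).2,
        (sys.greenR_extrema ε r s).2]
  · refine ⟨RennerCoxeter.rookSystem, RennerCoxeter.isStandardRook_rookSystem, ?_,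
      RennerCoxeter.isAbsMin_rookA, RennerCoxeter.isAbsMin_rookC, ?_,
      RennerCoxeter.exists_not_absMinLE⟩
    · rw [← RennerCoxeter.val_plus_eq_rookA, ← RennerCoxeter.val_plus_eq_rookC]
      exact (RennerCoxeter.RennerCoxeterSystem.StdTriple.adhLE_val_iff .plus).2
        RennerCoxeter.rookTriple_le
    · rw [← RennerCoxeter.val_plus_eq_rookB, ← RennerCoxeter.val_plus_eq_one,
        RennerCoxeter.RennerCoxeterSystem.StdTriple.adhLE_val_iff]
      exact RennerCoxeter.rookTriple_not_le
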